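/- **Theorem 3.7 (proto-differentiability of normal cone mappings for parabolically regular sets).** Notation. Let $\Omega\subset\mathbb R^n$ be closed, $\bar x\in\Omega$. All of the following is with respect to the Euclidean norm and inner product; $t_k\downarrow0$ means $t_k>0$, $t_k\to 0$. * $T_S(x)=\{w:\exists\,t_k\downarrow0,\ w_k\to w,\ x+t_kw_k\in S\}$ is the tangent cone to a set $S$ at $x\in S$; $T^2_\Omega(\bar x,w)=\{u:\exists\,t_k\downarrow 0,\ u_k\to u,\ \bar x+t_kw+\tfrac12t_k^2u_k\in\Omega\}$ is the second-order tangent set. * $\widehat N_S(x)=\{v:\limsup_{y\to x,\,y\in S}\langle v,y-x\rangle/\|y-x\|\le0\}$ for $x\in S$, and $N_S(x)=\{v:\exists\,x_k\to x,\ x_k\in S,\ v_k\to v,\ v_k\in\widehat N_S(x_k)\}$ is the limiting normal cone; $N_S(x)=\emptyset$ for $x\notin S$. * For $\varphi:\mathbb R^n\to[-\infty,\infty]$ with $\varphi(x)$ finite, $\partial\varphi(x)=\{v:(v,-1)\in N_{\mathrm{epi}\,\varphi}(x,\varphi(x))\}$; $\partial\varphi(x)=\emptyset$ where $\varphi(x)$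 is not finite. * $\delta_\Omega$ is $0$ on $\Omega$ and $\infty$ elsewhere; $\Delta_t^2\delta_\Omega(\bar x,\bar v)(u)=\dfrac{\delta_\Omega(\bar x+tu)-\delta_\Omega(\bar x)-t\langle\bar v,u\rangle}{\frac12t^2}$ for $t>0$, and $d^2\delta_\Omega(\bar x,\bar v)(w)=\liminf_{t\downarrow0,\,u\to w}\Delta^2_t\delta_\Omega(\bar x,\bar v)(u)$. The function $\delta_\Omega$ is *twice epi-differentiable* at $\bar x$ for $\bar v$ if $\mathrm{epi}\,d^2\delta_\Omega(\bar x,\bar v)$ is closed and $\mathrm{dist}(z;\mathrm{epi}\,\Delta_t^2\delta_\Omega(\bar x,\bar v))\to\mathrm{dist}(z;\mathrm{epi}\,d^2\delta_\Omega(\bar x,\bar v))$ as $t\downarrow0$ for every $z\in\mathbb R^{n+1}$. * $K_\Omega(\bar x,\bar v)=T_\Omega(\bar x)\cap\{\bar v\}^\perp$ is the critical cone. * $\Omega$ is *parabolically derivable* at $\bar x$ for $w$ if $T^2_\Omega(\bar x,w)\neq\emptyset$ and for each $u\in T^2_\Omega(\bar x,w)$ there are $\varepsilon>0$ and $\xi:[0,\varepsilon]\to\Omega$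 with $\xi(0)=\bar x$, $\frac{\xi(t)-\xi(0)}{t}\to w$ and $\frac{\xi(t)-\xi(0)-tw}{\frac12t^2}\to u$ as $t\downarrow0$. * $\Omega$ is *prox-regular* at $\bar x$ for $\bar v\in N_\Omega(\bar x)$ if there are $\varepsilon,r>0$ such that $\langle v,u-x\rangle\le\frac r2\|u-x\|^2$ whenever $v\in N_\Omega(x)$, $\|(x,v)-(\bar x,\bar v)\|\le\varepsilon$, $u\in\Omega$, $\|u-\bar x\|\le\varepsilon$. * $\Omega$ is *parabolically regular* at $\bar x$ for $\bar v$ if for every $w$ with $d^2\delta_\Omega(\bar x,\bar v)(w)<\infty$ there are $t_k\downarrow0$, $w_k\to w$ with $\Delta^2_{t_k}\delta_\Omega(\bar x,\bar v)(w_k)\to d^2\delta_\Omega(\bar x,\bar v)(w)$ and $\limsup_k\|w_k-w\|/t_k<\infty$. * For a set-valued mapping $F$ and $y\in F(x)$, the graphical derivative is $DF(x,y)(w)=\{z:(w,z)\in T_{\mathrm{gph}F}(x,y)\}$; $F$ is *proto-differentiable* at $x$ for $y$ if for each $\omega\in T_{\mathrm{gph}F}(x,y)$ there are $\varepsilon>0$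 and $\xi:[0,\varepsilon]\to\mathrm{gph}F$ with $\xi(0)=(x,y)$ and $\frac{\xi(t)-\xi(0)}{t}\to\omega$ as $t\downarrow0$. $P_\Omega(u)$ is the set of points of $\Omega$ nearest to $u$. Statement. Let $\Omega\subset\mathbb R^n$ be closed, $\bar x\in\Omega$ and $\bar v\in N_\Omega(\bar x)$. Assume that $\Omega$ is parabolically derivable at $\bar x$ for every $w\in K_\Omega(\bar x,\bar v)$, and that $\Omega$ is prox-regular and parabolically regular at $\bar x$ for $\bar v$. Then all of the following hold: (i) $\delta_\Omega$ is twice epi-differentiable at $\bar x$ for $\bar v$. (ii) $N_\Omega$ is proto-differentiable at $\bar x$ for $\bar v$, and $DN_\Omega(\bar x,\bar v)(w)=\partial\big(\tfrac12d^2\delta_\Omega(\bar x,\bar v)\big)(w)$ for all $w\in\mathbb R^n$. (iii) There is $r_0>0$ such that for every $r\in(0,r_0)$, with $\bar u:=\bar x+r\bar v$: the projection $P_\Omega$ is single-valued on a neighborhood of $\bar u$ with $P_\Omega(\bar u)=\bar x$; it is semidifferentiable at $\bar u$, i.e. for every $w\in\mathbb R^n$ the limit $D(w)$ of $\frac{P_\Omega(\bar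 u+tu)-P_\Omega(\bar u)}{t}$ as $t\downarrow0$, $u\to w$ exists; and for all $w\in\mathbb R^n$ $$DP_\Omega(\bar u,\bar x)(w)=\{D(w)\}=\big(I+rDN_\Omega(\bar x,\bar v)\big)^{-1}(w)=\{z:\ w\in z+r\,DN_\Omega(\bar x,\bar v)(z)\}.$$ -/

import Mathlib

open Filter Topology Set
open scoped RealInnerProductSpace

namespace VarAnalysis

noncomputable section

/-! ### Set convergence, tangents and normals -/

/-- The sets `S t`, `t > 0`, converge to `L` as `t ↓ 0`: `L` is closed and
`dist (w; S t) → dist (w; L)` for every `w`. Distances are extended ones, so that the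
distance to the empty set is `∞`. -/
def SetsConverge {E : Type*} [PseudoEMetricSpace E] (S : ℝ → Set E) (L : Set E) : Prop :=
  IsClosed L ∧
    ∀ w : E, Tendsto (fun t => Metric.infEDist w (S t)) (𝓝[>] 0) (𝓝 (Metric.infEDist w L))

/-- The (Bouligand) tangent cone `T_Ω(x)`; the condition `t k ↓ 0` is read as `t k > 0` and
`t k → 0`. -/
def tangentCone {E : Type*} [NormedAddCommGroup E] [NormedSpace ℝ E]
    (Ω : Set E) (x : E) : Set E :=
  {w | ∃ (t : ℕ → ℝ) (u : ℕ → E), (∀ k, 0 < t k) ∧ Tendsto t atTop (𝓝 0) ∧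
    Tendsto u atTop (𝓝 w) ∧ ∀ k, x + t k • u k ∈ Ω}

/-- The second-order tangent set `T²_Ω(x, w)`. -/
def secondTangentSet {E : Type*} [NormedAddCommGroup E] [NormedSpace ℝ E]
    (Ω : Set E) (x w : E) : Set E :=
  {u | ∃ (t : ℕ → ℝ) (z : ℕ → E), (∀ k, 0 < t k) ∧ Tendsto t atTop (𝓝 0) ∧
    Tendsto z atTop (𝓝 u) ∧ ∀ k, x + t k • w + ((1 / 2 : ℝ) * t k ^ 2) • z k ∈ Ω}

/-- The right derivative of the arc `ξ` at `0` is `w`. -/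
def HasRightDerivZero {E : Type*} [NormedAddCommGroup E] [NormedSpace ℝ E]
    (ξ : ℝ → E) (w : E) : Prop :=
  Tendsto (fun t : ℝ => t⁻¹ • (ξ t - ξ 0)) (𝓝[>] 0) (𝓝 w)

/-- The parabolic second right derivative at `0` of the arc `ξ`, whose first right derivative
is `w`, is `u`. -/
def HasSecondRightDerivZero {E : Type*} [NormedAddCommGroup E] [NormedSpace ℝ E]
    (ξ : ℝ → E) (w u : E) : Prop :=
  Tendsto (fun t : ℝ => ((1 / 2 : ℝ) * t ^ 2)⁻¹ • (ξ t - ξ 0 - t • w)) (𝓝[>] 0) (𝓝 u)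

/-- `Ω` is geometrically derivable at `x`: every tangent vector is the right derivative of an
arc `ξ : [0, ε] → Ω` issuing from `x`. -/
def GeometricallyDerivable {E : Type*} [NormedAddCommGroup E] [NormedSpace ℝ E]
    (Ω : Set E) (x : E) : Prop :=
  ∀ w ∈ tangentCone Ω x, ∃ ε > (0 : ℝ), ∃ ξ : ℝ → E,
    (∀ t ∈ Icc 0 ε, ξ t ∈ Ω) ∧ ξ 0 = x ∧ HasRightDerivZero ξ w

/-- `Ω` is parabolically derivable at `x` for `w`. -/
def ParabolicallyDerivable {E : Type*} [NormedAddCommGroup E] [NormedSpace ℝ E]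
    (Ω : Set E) (x w : E) : Prop :=
  (secondTangentSet Ω x w).Nonempty ∧
    ∀ u ∈ secondTangentSet Ω x w, ∃ ε > (0 : ℝ), ∃ ξ : ℝ → E,
      (∀ t ∈ Icc 0 ε, ξ t ∈ Ω) ∧ ξ 0 = x ∧ HasRightDerivZero ξ w ∧
        HasSecondRightDerivZero ξ w u

/-- The regular (Fréchet) normal cone at a point `x` of `Ω`: the condition says that the upper
limit of `⟪v, y - x⟫ / ‖y - x‖` as `y → x` in `Ω` is at most `0`. It is empty for `x ∉ Ω`. -/
def regularNormalCone {E : Type*} [NormedAddCommGroup E] [InnerProductSpace ℝ E]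
    (Ω : Set E) (x : E) : Set E :=
  {v | x ∈ Ω ∧ ∀ ε > (0 : ℝ), ∀ᶠ y in 𝓝[Ω] x, ⟪v, y - x⟫ ≤ ε * ‖y - x‖}

/-- The limiting (Mordukhovich) normal cone `N_Ω(x)`; it is empty for `x ∉ Ω`. -/
def normalCone {E : Type*} [NormedAddCommGroup E] [InnerProductSpace ℝ E]
    (Ω : Set E) (x : E) : Set E :=
  {v | x ∈ Ω ∧ ∃ (y : ℕ → E) (u : ℕ → E), (∀ k, y k ∈ Ω) ∧ Tendsto y atTop (𝓝 x) ∧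
    Tendsto u atTop (𝓝 v) ∧ ∀ k, u k ∈ regularNormalCone Ω (y k)}

/-- The critical cone `K_Ω(x, v)`. -/
def criticalCone {E : Type*} [NormedAddCommGroup E] [InnerProductSpace ℝ E]
    (Ω : Set E) (x v : E) : Set E :=
  {w | w ∈ tangentCone Ω x ∧ ⟪v, w⟫ = 0}

/-- `Ω` is prox-regular at `x₀` for `v₀`. The ball in the product space is Euclidean. -/
def ProxRegular {E : Type*} [NormedAddCommGroup E] [InnerProductSpace ℝ E]
    (Ω : Set E) (x₀ v₀ : E) : Prop :=
  v₀ ∈ normalCone Ω x₀ ∧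
    ∃ ε > (0 : ℝ), ∃ r > (0 : ℝ), ∀ x v u : E,
      v ∈ normalCone Ω x → ‖x - x₀‖ ^ 2 + ‖v - v₀‖ ^ 2 ≤ ε ^ 2 →
      u ∈ Ω → ‖u - x₀‖ ≤ ε → ⟪v, u - x⟫ ≤ r / 2 * ‖u - x‖ ^ 2

/-! ### Extended-real-valued functions -/

open Classical in
/-- The indicator function `δ_Ω`: `0` on `Ω` and `∞` outside. -/
def indicatorFn {E : Type*} (Ω : Set E) (x : E) : EReal :=
  if x ∈ Ω then 0 else ⊤

/-- The epigraph, as a subset of the Euclidean (`ℓ²`) product `E × ℝ`. -/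
def epigraph {E : Type*} (φ : E → EReal) : Set (WithLp 2 (E × ℝ)) :=
  {p | φ p.fst ≤ (p.snd : EReal)}

/-- The limiting subdifferential `∂φ(x)`, defined through the limiting normal cone to the
epigraph; it is empty where `φ` is not finite. -/
def subdifferential {E : Type*} [NormedAddCommGroup E] [InnerProductSpace ℝ E]
    (φ : E → EReal) (x : E) : Set E :=
  {v | ∃ α : ℝ, φ x = (α : EReal) ∧
    WithLp.toLp 2 (v, (-1 : ℝ)) ∈ normalCone (epigraph φ) (WithLp.toLp 2 (x, α))}

/-- The second-order difference quotient `Δ²_t φ(x, v)(u)`, for `φ x` finite and `t > 0`. -/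
def secondDiffQuot {E : Type*} [NormedAddCommGroup E] [InnerProductSpace ℝ E]
    (φ : E → EReal) (x v : E) (t : ℝ) (u : E) : EReal :=
  (φ (x + t • u) - φ x - ((t * ⟪v, u⟫ : ℝ) : EReal)) / (((1 / 2 : ℝ) * t ^ 2 : ℝ) : EReal)

/-- The second subderivative `d²φ(x, v)(w)`: the lower limit of the second-order difference
quotients at `u` as `t ↓ 0` and `u → w`. -/
def secondSubderiv {E : Type*} [NormedAddCommGroup E] [InnerProductSpace ℝ E]
    (φ : E → EReal) (x v w : E) : EReal :=
  liminf (fun p : ℝ × E => secondDiffQuot φ x v p.1 p.2) (𝓝[>] 0 ×ˢ 𝓝 w)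

/-- `φ` is twice epi-differentiable at `x` for `v`. -/
def TwiceEpiDifferentiable {E : Type*} [NormedAddCommGroup E] [InnerProductSpace ℝ E]
    (φ : E → EReal) (x v : E) : Prop :=
  SetsConverge (fun t => epigraph (secondDiffQuot φ x v t)) (epigraph (secondSubderiv φ x v))

/-- `Ω` is parabolically regular at `x` for `v`. -/
def ParabolicallyRegular {E : Type*} [NormedAddCommGroup E] [InnerProductSpace ℝ E]
    (Ω : Set E) (x v : E) : Prop :=
  ∀ w : E, secondSubderiv (indicatorFn Ω) x v w < ⊤ →
    ∃ (t : ℕ → ℝ) (u : ℕ → E), (∀ k, 0 < t k) ∧ Tendsto t atTop (𝓝 0) ∧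
      Tendsto u atTop (𝓝 w) ∧
      Tendsto (fun k => secondDiffQuot (indicatorFn Ω) x v (t k) (u k)) atTop
        (𝓝 (secondSubderiv (indicatorFn Ω) x v w)) ∧
      limsup (fun k => ((‖u k - w‖ / t k : ℝ) : EReal)) atTop < ⊤

/-! ### Set-valued mappings -/

/-- The graph of a set-valued mapping. -/
def graph {E F : Type*} (S : E → Set F) : Set (E × F) :=
  {p | p.2 ∈ S p.1}

/-- The inverse of a set-valued mapping. -/
def inverse {E F : Type*} (S : E → Set F) (y : F) : Set E :=
  {x | y ∈ S x}

/-- The set-valued mapping `I + r S`. -/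
def idAddSMul {E : Type*} [NormedAddCommGroup E] [NormedSpace ℝ E]
    (r : ℝ) (S : E → Set E) (x : E) : Set E :=
  {z | ∃ y ∈ S x, z = x + r • y}

/-- The graphical derivative `DS(x, y)`. -/
def graphicalDeriv {E F : Type*} [NormedAddCommGroup E] [NormedSpace ℝ E]
    [NormedAddCommGroup F] [NormedSpace ℝ F] (S : E → Set F) (x : E) (y : F) (u : E) : Set F :=
  {v | (u, v) ∈ tangentCone (graph S) (x, y)}

/-- `S` is proto-differentiable at `x` for `y`. -/
def ProtoDifferentiable {E F : Type*} [NormedAddCommGroup E] [NormedSpace ℝ E]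
    [NormedAddCommGroup F] [NormedSpace ℝ F] (S : E → Set F) (x : E) (y : F) : Prop :=
  GeometricallyDerivable (graph S) (x, y)

/-- The set-valued projection `P_Ω`: all nearest points of `Ω`. -/
def projection {E : Type*} [NormedAddCommGroup E] (Ω : Set E) (u : E) : Set E :=
  {p | p ∈ Ω ∧ ∀ q ∈ Ω, ‖u - p‖ ≤ ‖u - q‖}

/-- The single-valued mapping `f` is semidifferentiable at `x` with the semiderivative `D`:
for every `w`, `(f (x + t u) - f x) / t → D w` as `t ↓ 0` and `u → w`. -/
def HasSemiderivAt {E F : Type*} [NormedAddCommGroup E] [NormedSpace ℝ E]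
    [NormedAddCommGroup F] [NormedSpace ℝ F] (f : E → F) (D : E → F) (x : E) : Prop :=
  ∀ w : E, Tendsto (fun p : ℝ × E => p.1⁻¹ • (f (x + p.1 • p.2) - f x))
    (𝓝[>] 0 ×ˢ 𝓝 w) (𝓝 (D w))

end

end VarAnalysis

/-! Everything is read off the epigraphs `quotEpi` of half the second-order quotients of the
indicator; their outer limit `limEpi` is the epigraph of half the second subderivative.

Parabolic regularity turns a finite value of the second subderivative at `w` into a second-order
tangent `z` with that value equal to `-⟪v₀, z⟫`. Parabolic derivability then supplies an arc
realizing `z` for all small `t`, so the outer limit lies in the inner limit (`exists_recovery`).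
This is twice epi-differentiability.

Prox-regularity makes the normal cone mapping hypomonotone near `(x₀, v₀)`. Hence for small `r` the
projection is single-valued and obeys a Lipschitz estimate near `x₀ + r • v₀`, and `(x, v) ↦ (x + r
• v, x)` carries the graph of the normal cone mapping locally onto that of the projection. Quotients
of the projection are bounded and satisfy a proximal subgradient inequality for the second-order
quotients. By the recovery curves, every cluster point `z` in direction `w` makes `r⁻¹ • (w - z)` a
proximal subgradient, with global modulus `ρ`, of half the second subderivative. Since `r * ρ < 1`,
there is only one such `z`: the limit exists, and the change of coordinates transfers it to the
normal cone mapping.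

It remains to identify proximal with limiting subgradients. Solvability of all these resolvent
inclusions for small `r` forces half the second subderivative to be convex up to `ρ / 2 * ‖·‖ ^ 2`
(`hypoconvex_of_resolvents`), which makes the subgradient inequality global and stable under limits.
-/

namespace VarAnalysis

/-! ### Outer limits of families of sets -/

/-- The outer limit of the sets `S t` as `t ↓ 0`. -/
def outerLimit {X : Type*} [TopologicalSpace X] (S : ℝ → Set X) : Set X :=
  {x | ∃ᶠ p : ℝ × X in 𝓝[>] 0 ×ˢ 𝓝 x, p.2 ∈ S p.1}

theorem isClosed_outerLimit {X : Type*} [TopologicalSpace X] (S : ℝ → Set X) :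
    IsClosed (outerLimit S) := by
  rw [← isOpen_compl_iff, isOpen_iff_mem_nhds]
  intro x hx
  have hx' : ∀ᶠ p : ℝ × X in 𝓝[>] 0 ×ˢ 𝓝 x, ¬ p.2 ∈ S p.1 := not_frequently.1 hx
  obtain ⟨pa, ha, pb, hb, h⟩ := eventually_prod_iff.1 hx'
  filter_upwards [eventually_eventually_nhds.2 hb] with y hy
  exact not_frequently.2 (eventually_prod_iff.2 ⟨pa, ha, pb, hy, h⟩)

theorem mem_outerLimit_iff_seq {X : Type*} [TopologicalSpace X] [FirstCountableTopology X]
    {S : ℝ → Set X} {x : X} :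
    x ∈ outerLimit S ↔ ∃ (t : ℕ → ℝ) (q : ℕ → X), (∀ k, 0 < t k) ∧ Tendsto t atTop (𝓝 0) ∧
      Tendsto q atTop (𝓝 x) ∧ ∀ k, q k ∈ S (t k) := by
  constructor
  · intro h
    have hpos : ∀ᶠ p : ℝ × X in 𝓝[>] 0 ×ˢ 𝓝 x, 0 < p.1 :=
      tendsto_fst.eventually self_mem_nhdsWithin
    obtain ⟨ns, hns, hp⟩ := exists_seq_forall_of_frequently (h.and_eventually hpos)
    refine ⟨fun k => (ns k).1, fun k => (ns k).2, fun k => (hp k).2, ?_, tendsto_snd.comp hns,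
      fun k => (hp k).1⟩
    exact (tendsto_nhdsWithin_iff.1 (tendsto_fst.comp hns)).1
  · rintro ⟨t, q, ht, ht0, hq, h⟩
    have : Tendsto (fun k => (t k, q k)) atTop (𝓝[>] 0 ×ˢ 𝓝 x) :=
      (tendsto_nhdsWithin_iff.2 ⟨ht0, Eventually.of_forall ht⟩).prodMk hq
    exact this.frequently (Frequently.of_forall h)

/-- Convergence along a nontrivial filter puts the limit point into the outer limit. -/
theorem mem_outerLimit_of_tendsto {X ι : Type*} [TopologicalSpace X] {S : ℝ → Set X} {x : X}
    {F : Filter ι} [NeBot F] {t : ι → ℝ} {q : ι → X} (ht : Tendsto t F (𝓝[>] 0))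
    (hq : Tendsto q F (𝓝 x)) (h : ∀ᶠ i in F, q i ∈ S (t i)) : x ∈ outerLimit S :=
  Tendsto.frequently (p := fun p : ℝ × X => p.2 ∈ S p.1) (ht.prodMk hq) h.frequently

/-- In filter form, tangency is transported by a change of coordinates through `Tendsto.frequently`,
without sequences. -/
theorem tangentCone_eq_outerLimit {E : Type*} [NormedAddCommGroup E] [NormedSpace ℝ E]
    (Ω : Set E) (x : E) : tangentCone Ω x = outerLimit fun t => {u | x + t • u ∈ Ω} := by
  ext w
  rw [mem_outerLimit_iff_seq]
  rfl

/-- In a proper space, a set that contains the outer limit and is contained in the inner limit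
is the limit in the sense of distances. -/
theorem setsConverge_of_limits {X : Type*} [PseudoMetricSpace X] [ProperSpace X]
    {S : ℝ → Set X} {L : Set X} (hcl : IsClosed L)
    (hin : ∀ x ∈ L, ∃ q : ℝ → X, (∀ᶠ t in 𝓝[>] 0, q t ∈ S t) ∧ Tendsto q (𝓝[>] 0) (𝓝 x))
    (hout : outerLimit S ⊆ L) : SetsConverge S L := by
  refine ⟨hcl, fun w => tendsto_order.2 ⟨fun b hb => ?_, fun b hb => ?_⟩⟩
  · by_contra hcon
    obtain ⟨c, hbc, hc⟩ := exists_between hb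
    have hfr : ∃ᶠ t in 𝓝[>] (0 : ℝ), ∃ y ∈ S t, edist w y < c := by
      refine (not_eventually.1 hcon).mono fun t ht => ?_
      exact Metric.infEDist_lt_iff.1 ((not_lt.1 ht).trans_lt hbc)
    have : Nonempty X := ⟨w⟩
    choose! q hq using fun (t : ℝ) (h : ∃ y ∈ S t, edist w y < c) => h
    have : NeBot (𝓝[>] (0 : ℝ) ⊓ 𝓟 {t | ∃ y ∈ S t, edist w y < c}) :=
      frequently_mem_iff_neBot.1 hfr
    -- Refining the filter of bad parameters to an ultrafilter makes the bounded selection `q`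
    -- converge, with no subsequence to extract.
    set F := Ultrafilter.of (𝓝[>] (0 : ℝ) ⊓ 𝓟 {t | ∃ y ∈ S t, edist w y < c}) with hF
    have hF0 : (F : Filter ℝ) ≤ _ := Ultrafilter.of_le _
    have hFev : ∀ᶠ t in (F : Filter ℝ), ∃ y ∈ S t, edist w y < c :=
      (hF0.trans inf_le_right) (mem_principal_self _)
    have hctop : c ≠ ⊤ := (hc.trans_le le_top).ne
    have hball : ∀ᶠ t in (F : Filter ℝ), q t ∈ Metric.closedBall w c.toReal := by
      filter_upwards [hFev] with t ht
      rw [Metric.mem_closedBall, dist_comm, dist_edist]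
      exact ENNReal.toReal_mono hctop (hq t ht).2.le
    obtain ⟨x, -, hx⟩ := (isCompact_closedBall w c.toReal).ultrafilter_le_nhds' (F.map q) hball
    have hx' : Tendsto q (F : Filter ℝ) (𝓝 x) := hx
    have hxL : x ∈ L := hout (mem_outerLimit_of_tendsto (hF0.trans inf_le_left) hx'
      (hFev.mono fun t ht => (hq t ht).1))
    have hd : edist w x ≤ c :=
      le_of_tendsto (tendsto_const_nhds.edist hx') (hFev.mono fun t ht => (hq t ht).2.le)
    exact absurd ((Metric.infEDist_le_edist_of_mem hxL).trans hd) (not_le.2 hc)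
  · obtain ⟨x, hx, hxb⟩ := Metric.infEDist_lt_iff.1 hb
    obtain ⟨q, hq, hqx⟩ := hin x hx
    have : Tendsto (fun t => edist w (q t)) (𝓝[>] 0) (𝓝 (edist w x)) :=
      tendsto_const_nhds.edist hqx
    filter_upwards [hq, this.eventually (gt_mem_nhds hxb)] with t h1 h2
    exact (Metric.infEDist_le_edist_of_mem h1).trans_lt h2

/-! ### Epigraphs of the second-order difference quotients of an indicator function -/

section

variable {E : Type*} [NormedAddCommGroup E] [InnerProductSpace ℝ E]

/-- The epigraph of one half of the second-order difference quotient of `δ_Ω`. -/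
def quotEpi (Ω : Set E) (x v : E) (t : ℝ) : Set (E × ℝ) :=
  {q | x + t • q.1 ∈ Ω ∧ -⟪v, q.1⟫ / t ≤ q.2}

/-- The epigraph of one half of the second subderivative of `δ_Ω`, as an outer limit. -/
def limEpi (Ω : Set E) (x v : E) : Set (E × ℝ) :=
  outerLimit (quotEpi Ω x v)

theorem secondDiffQuot_indicator_of_mem {Ω : Set E} {x v u : E} {t : ℝ} (ht : 0 < t)
    (hx : x ∈ Ω) (hu : x + t • u ∈ Ω) :
    secondDiffQuot (indicatorFn Ω) x v t u = ((2 * (-⟪v, u⟫ / t) : ℝ) : EReal) := by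
  have h : (2 * (-⟪v, u⟫ / t) : ℝ) = (0 - 0 - t * ⟪v, u⟫) / ((1 / 2 : ℝ) * t ^ 2) := by
    field_simp
    ring
  rw [h]
  simp only [secondDiffQuot, indicatorFn, if_pos hx, if_pos hu]
  rw [EReal.coe_div, sub_zero, sub_zero, zero_sub, zero_sub, EReal.coe_neg]

theorem secondDiffQuot_indicator_of_notMem {Ω : Set E} {x v u : E} {t : ℝ} (ht : 0 < t)
    (hx : x ∈ Ω) (hu : x + t • u ∉ Ω) :
    secondDiffQuot (indicatorFn Ω) x v t u = ⊤ := by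
  simp only [secondDiffQuot, indicatorFn, if_pos hx, if_neg hu, sub_zero, EReal.top_sub_coe]
  exact EReal.top_div_of_pos_ne_top (by exact_mod_cast (by positivity : 0 < (1 / 2 : ℝ) * t ^ 2))
    (EReal.coe_ne_top _)

theorem secondDiffQuot_indicator_le_iff {Ω : Set E} {x v u : E} {t a : ℝ} (ht : 0 < t)
    (hx : x ∈ Ω) :
    secondDiffQuot (indicatorFn Ω) x v t u ≤ (a : EReal) ↔ (u, a / 2) ∈ quotEpi Ω x v t := by
  by_cases hu : x + t • u ∈ Ω
  · rw [secondDiffQuot_indicator_of_mem ht hx hu, EReal.coe_le_coe_iff]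
    simp only [quotEpi, mem_ofPred_eq, hu, true_and]
    constructor <;> intro h <;> linarith
  · rw [secondDiffQuot_indicator_of_notMem ht hx hu]
    simp [quotEpi, hu]

/-- A lower limit over `(t, u)` is at most `a` exactly when points of the epigraphs of the quotients
accumulate at height `a`; the halving comes from the normalization of `quotEpi`. -/
theorem secondSubderiv_le_iff {Ω : Set E} {x v w : E} {a : ℝ} (hx : x ∈ Ω) :
    secondSubderiv (indicatorFn Ω) x v w ≤ (a : EReal) ↔ (w, a / 2) ∈ limEpi Ω x v := by
  have hpos : ∀ᶠ p : ℝ × E in 𝓝[>] 0 ×ˢ 𝓝 w, 0 < p.1 :=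
    tendsto_fst.eventually self_mem_nhdsWithin
  rw [secondSubderiv, liminf_le_iff]
  constructor
  · intro h
    by_contra hcon
    have hev : ∀ᶠ p : ℝ × (E × ℝ) in 𝓝[>] 0 ×ˢ 𝓝 (w, a / 2), p.2 ∉ quotEpi Ω x v p.1 :=
      not_frequently.1 hcon
    rw [nhds_prod_eq] at hev
    obtain ⟨pa, ha, pb, hb, hp⟩ := eventually_prod_iff.1 hev
    obtain ⟨pc, hc, pd, hd, hp'⟩ := eventually_prod_iff.1 hb
    obtain ⟨η, hη, hη'⟩ := Metric.eventually_nhds_iff.1 hd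
    have h1 := h ((a + η : ℝ) : EReal) (by exact_mod_cast lt_add_of_pos_right a hη)
    obtain ⟨p, ⟨hlt, hpp⟩, hpa, hpc⟩ := ((h1.and_eventually hpos).and_eventually
      (ha.prod_mk hc)).exists
    refine hp hpa (hp' hpc (hη' (y := (a + η) / 2) ?_))
      ((secondDiffQuot_indicator_le_iff hpp hx).1 hlt.le)
    rw [Real.dist_eq, abs_lt]
    constructor <;> linarith
  · intro h y hy
    obtain ⟨c, hac, hcy⟩ := EReal.lt_iff_exists_real_btwn.1 hy
    have hac' : a / 2 < c / 2 := by
      have := EReal.coe_lt_coe_iff.1 hac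
      linarith
    have hT : Tendsto (fun p : ℝ × (E × ℝ) => (p.1, p.2.1)) (𝓝[>] 0 ×ˢ 𝓝 (w, a / 2))
        (𝓝[>] 0 ×ˢ 𝓝 w) :=
      tendsto_fst.prodMk ((continuous_fst.tendsto (w, a / 2)).comp tendsto_snd)
    have hc : ∀ᶠ p : ℝ × (E × ℝ) in 𝓝[>] 0 ×ˢ 𝓝 (w, a / 2), p.2.2 < c / 2 :=
      ((continuous_snd.tendsto (w, a / 2)).comp tendsto_snd).eventually (gt_mem_nhds hac')
    refine hT.frequently (((show ∃ᶠ p : ℝ × (E × ℝ) in _, _ from h).and_eventually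
      (hc.and (hT.eventually hpos))).mono ?_)
    rintro ⟨t, u, b⟩ ⟨h1, h2, h3⟩
    refine lt_of_le_of_lt ?_ hcy
    exact (secondDiffQuot_indicator_le_iff h3 hx).2 ⟨h1.1, h1.2.trans h2.le⟩

theorem half_secondSubderiv_le_iff {Ω : Set E} {x v w : E} {a : ℝ} (hx : x ∈ Ω) :
    ((1 / 2 : ℝ) : EReal) * secondSubderiv (indicatorFn Ω) x v w ≤ (a : EReal) ↔
      (w, a) ∈ limEpi Ω x v := by
  have h := secondSubderiv_le_iff (Ω := Ω) (x := x) (v := v) (w := w) (a := 2 * a) hx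
  rw [mul_div_cancel_left₀ a two_ne_zero] at h
  rw [← h]
  induction secondSubderiv (indicatorFn Ω) x v w using EReal.rec with
  | bot => simp [EReal.coe_mul_bot_of_pos]
  | top => simp [EReal.coe_mul_top_of_pos, -EReal.coe_mul]
  | coe b =>
    norm_cast
    constructor <;> intro h <;> linarith

/-- Tangency and the lower quadratic bound for points of the limit epigraph, under the quadratic
inequality for the reference normal vector. -/
theorem mem_limEpi_bounds {Ω : Set E} {x v : E} {ε ρ : ℝ} (hε : 0 < ε)
    (hv : ∀ u ∈ Ω, ‖u - x‖ ≤ ε → ⟪v, u - x⟫ ≤ ρ / 2 * ‖u - x‖ ^ 2) {w : E} {a : ℝ}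
    (h : (w, a) ∈ limEpi Ω x v) :
    w ∈ criticalCone Ω x v ∧ -(ρ / 2 * ‖w‖ ^ 2) ≤ a := by
  obtain ⟨t, q, ht, ht0, hq, hmem⟩ := mem_outerLimit_iff_seq.1 h
  have hq1 : Tendsto (fun k => (q k).1) atTop (𝓝 w) := (continuous_fst.tendsto _).comp hq
  have hq2 : Tendsto (fun k => (q k).2) atTop (𝓝 a) := (continuous_snd.tendsto _).comp hq
  have hin : Tendsto (fun k => ⟪v, (q k).1⟫) atTop (𝓝 ⟪v, w⟫) := tendsto_const_nhds.inner hq1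
  have hsm : Tendsto (fun k => ‖t k • (q k).1‖) atTop (𝓝 0) := by
    simpa using (ht0.smul hq1).norm
  -- The quadratic inequality at `x + t k • (q k).1`, divided by `t k`; a second division below
  -- yields the lower bound on `a`.
  have hlow : ∀ᶠ k in atTop, ⟪v, (q k).1⟫ ≤ t k * (ρ / 2 * ‖(q k).1‖ ^ 2) := by
    filter_upwards [hsm.eventually (gt_mem_nhds hε)] with k hk
    have h1 := hv _ (hmem k).1 (by simpa using hk.le)
    rw [add_sub_cancel_left, inner_smul_right, norm_smul, mul_pow, Real.norm_eq_abs, sq_abs] at h1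
    have h2 : t k * ⟪v, (q k).1⟫ ≤ t k * (t k * (ρ / 2 * ‖(q k).1‖ ^ 2)) := by
      linarith
    exact le_of_mul_le_mul_left h2 (ht k)
  have hup : ∀ k, -⟪v, (q k).1⟫ ≤ (q k).2 * t k := fun k => (div_le_iff₀ (ht k)).1 (hmem k).2
  refine ⟨⟨⟨t, _, ht, ht0, hq1, fun k => (hmem k).1⟩, le_antisymm ?_ ?_⟩, ?_⟩
  · refine le_of_tendsto_of_tendsto hin ?_ hlow
    simpa using ht0.mul (tendsto_const_nhds.mul (hq1.norm.pow 2))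
  · have h1 := le_of_tendsto_of_tendsto' hin.neg (hq2.mul ht0) hup
    linarith
  · refine le_of_tendsto_of_tendsto (tendsto_const_nhds.mul (hq1.norm.pow 2)).neg hq2 ?_
    filter_upwards [hlow] with k hk
    have h1 := hup k
    have h2 : t k * -(ρ / 2 * ‖(q k).1‖ ^ 2) ≤ t k * (q k).2 := by linarith
    exact le_of_mul_le_mul_left h2 (ht k)

/-- `Ω` is prox-regular at `x₀` for `v₀` with the radius `ε` and the modulus `ρ`. -/
def ProxRegularWith (Ω : Set E) (x₀ v₀ : E) (ε ρ : ℝ) : Prop :=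
  0 < ε ∧ 0 < ρ ∧ v₀ ∈ normalCone Ω x₀ ∧
    ∀ x v u : E, v ∈ normalCone Ω x → ‖x - x₀‖ ^ 2 + ‖v - v₀‖ ^ 2 ≤ ε ^ 2 →
      u ∈ Ω → ‖u - x₀‖ ≤ ε → ⟪v, u - x⟫ ≤ ρ / 2 * ‖u - x‖ ^ 2

theorem ProxRegularWith.inner_le {Ω : Set E} {x₀ v₀ : E} {ε ρ : ℝ}
    (H : ProxRegularWith Ω x₀ v₀ ε ρ) :
    ∀ u ∈ Ω, ‖u - x₀‖ ≤ ε → ⟪v₀, u - x₀⟫ ≤ ρ / 2 * ‖u - x₀‖ ^ 2 :=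
  fun u hu hue => H.2.2.2 x₀ v₀ u H.2.2.1 (by simp [sq_nonneg]) hu hue

/-- The reference second subderivative is real wherever it is not `∞`. -/
theorem exists_real_eq_secondSubderiv {Ω : Set E} {x v w : E} {ε ρ : ℝ} (hx : x ∈ Ω) (hε : 0 < ε)
    (hv : ∀ u ∈ Ω, ‖u - x‖ ≤ ε → ⟪v, u - x⟫ ≤ ρ / 2 * ‖u - x‖ ^ 2) {a : ℝ}
    (h : (w, a) ∈ limEpi Ω x v) :
    ∃ d : ℝ, secondSubderiv (indicatorFn Ω) x v w = d ∧ d ≤ 2 * a := by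
  have h1 : secondSubderiv (indicatorFn Ω) x v w ≤ ((2 * a : ℝ) : EReal) := by
    rw [secondSubderiv_le_iff hx]
    simpa using h
  have hbot : secondSubderiv (indicatorFn Ω) x v w ≠ ⊥ := by
    intro hb
    have h2 : secondSubderiv (indicatorFn Ω) x v w ≤ ((-(ρ * ‖w‖ ^ 2) - 1 : ℝ) : EReal) := by
      rw [hb]
      exact bot_le
    have := (mem_limEpi_bounds hε hv ((secondSubderiv_le_iff hx).1 h2)).2
    linarith
  have htop : secondSubderiv (indicatorFn Ω) x v w ≠ ⊤ :=
    (h1.trans_lt (EReal.coe_lt_top _)).ne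
  refine ⟨_, (EReal.coe_toReal htop hbot).symm, ?_⟩
  rw [← EReal.coe_le_coe_iff, EReal.coe_toReal htop hbot]
  exact h1

/-- Under parabolic regularity, the second subderivative at `w` is attained by the second-order
tangent vectors for `w`. -/
theorem ParabolicallyRegular.exists_mem_secondTangentSet [FiniteDimensional ℝ E] {Ω : Set E}
    {x v w : E} (hpar : ParabolicallyRegular Ω x v) (hx : x ∈ Ω) (hw : ⟪v, w⟫ = 0) {d : ℝ}
    (hd : secondSubderiv (indicatorFn Ω) x v w = d) :
    ∃ z ∈ secondTangentSet Ω x w, -⟪v, z⟫ = d := by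
  have : ProperSpace E := FiniteDimensional.proper ℝ E
  obtain ⟨t, u, ht, ht0, -, hlim, hsup⟩ := hpar w (by rw [hd]; exact EReal.coe_lt_top d)
  rw [hd] at hlim
  obtain ⟨C, hC, -⟩ := EReal.lt_iff_exists_real_btwn.1 hsup
  have hC' := eventually_lt_of_limsup_lt hC
  have hlt := hlim.eventually (gt_mem_nhds (EReal.coe_lt_top d))
  obtain ⟨N, hN⟩ := eventually_atTop.1 (hC'.and hlt)
  have hmem : ∀ k, x + t (k + N) • u (k + N) ∈ Ω := fun k => by
    by_contra hcon
    have := (hN (k + N) (Nat.le_add_left N k)).2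
    rw [secondDiffQuot_indicator_of_notMem (ht _) hx hcon] at this
    exact lt_irrefl _ this
  -- Chosen so that `x + t • u = x + t • w + (t ^ 2 / 2) • z`; the bound on `‖u - w‖ / t` keeps `z`
  -- in a ball.
  set z : ℕ → E := fun k => (2 / t (k + N)) • (u (k + N) - w) with hz
  have hzb : ∀ k, z k ∈ Metric.closedBall (0 : E) (2 * C) := fun k => by
    have h1 := EReal.coe_lt_coe_iff.1 (hN (k + N) (Nat.le_add_left N k)).1
    rw [mem_closedBall_zero_iff, hz]
    simp only [norm_smul, Real.norm_eq_abs, abs_of_pos (div_pos two_pos (ht (k + N)))]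
    rw [div_mul_eq_mul_div, mul_div_assoc]
    linarith
  obtain ⟨z₀, -, φ, hφ, hzφ⟩ := tendsto_subseq_of_bounded Metric.isBounded_closedBall hzb
  have hφN : Tendsto (fun k => φ k + N) atTop atTop :=
    (tendsto_add_atTop_nat N).comp hφ.tendsto_atTop
  have hu : ∀ k, u (k + N) = w + (t (k + N) / 2) • z k := fun k => by
    have := (ht (k + N)).ne'
    simp only [hz, smul_smul]
    rw [show t (k + N) / 2 * (2 / t (k + N)) = 1 by field_simp, one_smul, add_sub_cancel]
  refine ⟨z₀, ⟨fun k => t (φ k + N), z ∘ φ, fun k => ht _, ht0.comp hφN, hzφ, fun k => ?_⟩, ?_⟩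
  · have h1 := hmem (φ k)
    rw [hu] at h1
    convert h1 using 1
    rw [smul_add, smul_smul, ← add_assoc]
    congr 2
    ring
  · have h1 : Tendsto (fun k => -⟪v, z (φ k)⟫) atTop (𝓝 (-⟪v, z₀⟫)) :=
      (tendsto_const_nhds.inner hzφ).neg
    refine tendsto_nhds_unique h1 ?_
    rw [← EReal.tendsto_coe]
    refine (hlim.comp hφN).congr fun k => ?_
    have h2 := (ht (φ k + N)).ne'
    simp only [Function.comp_apply]
    rw [secondDiffQuot_indicator_of_mem (ht _) hx (hmem (φ k)), hu, inner_add_right,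
      inner_smul_right, hw]
    congr 1
    field_simp
    ring

/-- The limit epigraph is contained in the inner limit of the epigraphs of the second-order
difference quotients. -/
theorem exists_recovery [FiniteDimensional ℝ E] {Ω : Set E} {x v : E} {ε ρ : ℝ} (hx : x ∈ Ω)
    (H : ProxRegularWith Ω x v ε ρ)
    (hderiv : ∀ w ∈ criticalCone Ω x v, ParabolicallyDerivable Ω x w)
    (hpar : ParabolicallyRegular Ω x v) :
    ∀ p ∈ limEpi Ω x v, ∃ q : ℝ → E × ℝ, (∀ᶠ t in 𝓝[>] 0, q t ∈ quotEpi Ω x v t) ∧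
      Tendsto q (𝓝[>] 0) (𝓝 p) := by
  rintro ⟨w, a⟩ hp
  obtain ⟨d, hd, hda⟩ := exists_real_eq_secondSubderiv hx H.1 H.inner_le hp
  have hw := (mem_limEpi_bounds H.1 H.inner_le hp).1
  obtain ⟨z, hz, hzd⟩ := hpar.exists_mem_secondTangentSet hx hw.2 hd
  obtain ⟨η, hη, ξ, hξ, hξ0, hξ1, hξ2⟩ := (hderiv w hw).2 z hz
  unfold HasRightDerivZero at hξ1
  unfold HasSecondRightDerivZero at hξ2
  rw [hξ0] at hξ1 hξ2
  have hpos : ∀ᶠ t : ℝ in 𝓝[>] 0, 0 < t := self_mem_nhdsWithin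
  have hquot : Tendsto (fun t : ℝ => -⟪v, t⁻¹ • (ξ t - x)⟫ / t) (𝓝[>] 0) (𝓝 (d / 2)) := by
    have h1 : Tendsto (fun t : ℝ => -⟪v, ((1 / 2 : ℝ) * t ^ 2)⁻¹ • (ξ t - x - t • w)⟫ / 2)
        (𝓝[>] 0) (𝓝 (-⟪v, z⟫ / 2)) := ((tendsto_const_nhds.inner hξ2).neg).div_const 2
    rw [hzd] at h1
    refine h1.congr' ?_
    filter_upwards [hpos] with t ht
    simp only [inner_smul_right, inner_sub_right, hw.2]
    field_simp
    ring
  -- The point on the graph of the quotient tends to height `d / 2`; the nonnegative shift `a - d /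
  -- 2` lifts the limit to `a`.
  refine ⟨fun t => (t⁻¹ • (ξ t - x), -⟪v, t⁻¹ • (ξ t - x)⟫ / t + (a - d / 2)), ?_, ?_⟩
  · filter_upwards [hpos, mem_nhdsWithin_of_mem_nhds (Iic_mem_nhds hη)] with t ht htη
    refine ⟨?_, ?_⟩
    · simp only [smul_smul, mul_inv_cancel₀ ht.ne', one_smul, add_sub_cancel]
      exact hξ t ⟨ht.le, htη⟩
    · simp only
      linarith
  · refine hξ1.prodMk_nhds ?_
    simpa using hquot.add_const (a - d / 2)

theorem twiceEpiDifferentiable_indicatorFn [FiniteDimensional ℝ E] {Ω : Set E} {x v : E}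
    (hx : x ∈ Ω)
    (hrec : ∀ p ∈ limEpi Ω x v, ∃ q : ℝ → E × ℝ, (∀ᶠ t in 𝓝[>] 0, q t ∈ quotEpi Ω x v t) ∧
      Tendsto q (𝓝[>] 0) (𝓝 p)) :
    TwiceEpiDifferentiable (indicatorFn Ω) x v := by
  have : ProperSpace (WithLp 2 (E × ℝ)) := FiniteDimensional.proper ℝ _
  have hpos : ∀ᶠ t : ℝ in 𝓝[>] 0, 0 < t := self_mem_nhdsWithin
  set Φ : WithLp 2 (E × ℝ) → E × ℝ := fun p => (p.fst, p.snd / 2) with hΦ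
  have hΦc : Continuous Φ := by
    have h := WithLp.prod_continuous_ofLp 2 E ℝ
    exact (continuous_fst.comp h).prodMk ((continuous_snd.comp h).div_const 2)
  have hL : epigraph (secondSubderiv (indicatorFn Ω) x v) = Φ ⁻¹' limEpi Ω x v := by
    ext p
    exact secondSubderiv_le_iff hx
  refine setsConverge_of_limits ?_ ?_ ?_
  · rw [hL]
    exact (isClosed_outerLimit _).preimage hΦc
  · intro p hp
    rw [hL] at hp
    obtain ⟨q, hq, hqp⟩ := hrec _ hp
    refine ⟨fun t => WithLp.toLp 2 ((q t).1, 2 * (q t).2), ?_, ?_⟩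
    · filter_upwards [hq, hpos] with t h1 h2
      refine (secondDiffQuot_indicator_le_iff h2 hx).2 ?_
      simpa using h1
    · have h1 : Tendsto (fun t => ((q t).1, 2 * (q t).2)) (𝓝[>] 0) (𝓝 (p.fst, p.snd)) := by
        refine ((continuous_fst.tendsto _).comp hqp).prodMk_nhds ?_
        have h2 := ((continuous_snd.tendsto _).comp hqp).const_mul 2
        simpa [hΦ, mul_div_cancel₀] using h2
      exact ((WithLp.prod_continuous_toLp 2 E ℝ).tendsto _).comp h1
  · intro p hp
    rw [hL]
    have hT : Tendsto (fun y : ℝ × WithLp 2 (E × ℝ) => (y.1, Φ y.2)) (𝓝[>] 0 ×ˢ 𝓝 p)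
        (𝓝[>] 0 ×ˢ 𝓝 (Φ p)) :=
      tendsto_fst.prodMk ((hΦc.tendsto p).comp tendsto_snd)
    refine Tendsto.frequently (p := fun y : ℝ × (E × ℝ) => y.2 ∈ quotEpi Ω x v y.1) hT ?_
    refine ((show ∃ᶠ y : ℝ × WithLp 2 (E × ℝ) in _, _ from hp).and_eventually
      (tendsto_fst.eventually hpos)).mono ?_
    rintro ⟨t, y⟩ ⟨h1, h2⟩
    exact (secondDiffQuot_indicator_le_iff h2 hx).1 h1

/-! ### Projections onto prox-regular sets -/

theorem projection_nonempty [FiniteDimensional ℝ E] {Ω : Set E} (hcl : IsClosed Ω)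
    (hne : Ω.Nonempty) (u : E) : (projection Ω u).Nonempty := by
  have : ProperSpace E := FiniteDimensional.proper ℝ E
  obtain ⟨y, hy, hd⟩ := hcl.exists_infDist_eq_dist hne u
  refine ⟨y, hy, fun q hq => ?_⟩
  rw [← dist_eq_norm, ← dist_eq_norm, ← hd]
  exact Metric.infDist_le_dist_of_mem hq

theorem inner_le_of_mem_projection {Ω : Set E} {u p y : E} (hp : p ∈ projection Ω u)
    (hy : y ∈ Ω) : ⟪u - p, y - p⟫ ≤ 1 / 2 * ‖y - p‖ ^ 2 := by
  have h1 := pow_le_pow_left₀ (norm_nonneg _) (hp.2 y hy) 2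
  rw [show u - y = (u - p) - (y - p) by abel, norm_sub_sq_real (u - p) (y - p)] at h1
  linarith

theorem regularNormalCone_subset_normalCone (Ω : Set E) (x : E) :
    regularNormalCone Ω x ⊆ normalCone Ω x := fun v hv =>
  ⟨hv.1, fun _ => x, fun _ => v, fun _ => hv.1, tendsto_const_nhds, tendsto_const_nhds,
    fun _ => hv⟩

theorem smul_sub_mem_normalCone_of_mem_projection {Ω : Set E} {u p : E} {c : ℝ} (hc : 0 ≤ c)
    (hp : p ∈ projection Ω u) : c • (u - p) ∈ normalCone Ω p := by
  refine regularNormalCone_subset_normalCone Ω p ⟨hp.1, fun ε hε => ?_⟩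
  have hT : Tendsto (fun y : E => c * (1 / 2 * ‖y - p‖)) (𝓝[Ω] p) (𝓝 0) := by
    have : Continuous fun y : E => c * (1 / 2 * ‖y - p‖) := by fun_prop
    simpa using (this.tendsto p).mono_left nhdsWithin_le_nhds
  filter_upwards [hT.eventually (gt_mem_nhds hε), self_mem_nhdsWithin] with y h1 h2
  rw [real_inner_smul_left]
  have h3 := mul_le_mul_of_nonneg_left (inner_le_of_mem_projection hp h2) hc
  have h4 := mul_le_mul_of_nonneg_right h1.le (norm_nonneg (y - p))
  nlinarith

namespace ProxRegularWith

variable {Ω : Set E} {x₀ v₀ : E} {ε ρ r : ℝ}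

theorem eventually_local (H : ProxRegularWith Ω x₀ v₀ ε ρ) :
    ∀ᶠ q : E × E in 𝓝 (x₀, v₀), ‖q.1 - x₀‖ ^ 2 + ‖q.2 - v₀‖ ^ 2 ≤ ε ^ 2 := by
  have hc : Continuous fun q : E × E => ‖q.1 - x₀‖ ^ 2 + ‖q.2 - v₀‖ ^ 2 := by fun_prop
  refine (hc.tendsto (x₀, v₀)).eventually (Iic_mem_nhds ?_)
  simpa using pow_pos H.1 2

theorem norm_le_of_local (H : ProxRegularWith Ω x₀ v₀ ε ρ) {x v : E}
    (h : ‖x - x₀‖ ^ 2 + ‖v - v₀‖ ^ 2 ≤ ε ^ 2) : ‖x - x₀‖ ≤ ε := by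
  refine (sq_le_sq₀ (norm_nonneg _) H.1.le).1 ?_
  have := sq_nonneg ‖v - v₀‖
  linarith

/-- The localized normal cone mapping is hypomonotone. -/
theorem hypomonotone (H : ProxRegularWith Ω x₀ v₀ ε ρ) {x₁ v₁ x₂ v₂ : E}
    (h₁ : v₁ ∈ normalCone Ω x₁) (hl₁ : ‖x₁ - x₀‖ ^ 2 + ‖v₁ - v₀‖ ^ 2 ≤ ε ^ 2)
    (h₂ : v₂ ∈ normalCone Ω x₂) (hl₂ : ‖x₂ - x₀‖ ^ 2 + ‖v₂ - v₀‖ ^ 2 ≤ ε ^ 2) :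
    -(ρ * ‖x₁ - x₂‖ ^ 2) ≤ ⟪v₁ - v₂, x₁ - x₂⟫ := by
  have a₁ := H.2.2.2 x₁ v₁ x₂ h₁ hl₁ h₂.1 (H.norm_le_of_local hl₂)
  have a₂ := H.2.2.2 x₂ v₂ x₁ h₂ hl₂ h₁.1 (H.norm_le_of_local hl₁)
  rw [norm_sub_rev, ← neg_sub x₁ x₂, inner_neg_right] at a₁
  rw [inner_sub_left]
  linarith

/-- Comparison with `x₀` puts `p` within `ε` of `x₀`, so the quadratic inequality for `v₀` applies.
With `δ` the distance from `u` to `x₀ + r • v₀`, it gives `(1 - r * ρ) * ‖p - x₀‖ ^ 2 ≤ 4 * δ * (r *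
‖v₀‖) + 4 * δ ^ 2`. -/
theorem eventually_projection_near (H : ProxRegularWith Ω x₀ v₀ ε ρ) (hx₀ : x₀ ∈ Ω) (hr : 0 < r)
    (hrρ : r * ρ < 1) (hrv : 4 * (r * ‖v₀‖) ≤ ε) {η : ℝ} (hη : 0 < η) :
    ∀ᶠ u in 𝓝 (x₀ + r • v₀), ∀ p ∈ projection Ω u, ‖p - x₀‖ < η := by
  have hε := H.1
  have hc : Tendsto (fun u : E => ‖u - (x₀ + r • v₀)‖) (𝓝 (x₀ + r • v₀)) (𝓝 0) := by
    have : Continuous fun u : E => ‖u - (x₀ + r • v₀)‖ := by fun_prop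
    simpa using this.tendsto (x₀ + r • v₀)
  have hc' : Tendsto (fun u : E => 4 * ‖u - (x₀ + r • v₀)‖ * (r * ‖v₀‖) +
      4 * ‖u - (x₀ + r • v₀)‖ ^ 2) (𝓝 (x₀ + r • v₀)) (𝓝 0) := by
    simpa using ((hc.const_mul 4).mul_const (r * ‖v₀‖)).add ((hc.pow 2).const_mul 4)
  have hpos : 0 < (1 - r * ρ) * η ^ 2 := mul_pos (by linarith) (pow_pos hη 2)
  filter_upwards [hc'.eventually (gt_mem_nhds hpos),
    hc.eventually (gt_mem_nhds (show 0 < ε / 4 by linarith))] with u h1 h2 p hp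
  set δ := ‖u - (x₀ + r • v₀)‖ with hδ
  have hδ0 : 0 ≤ δ := norm_nonneg _
  have hrn : ‖r • v₀‖ = r * ‖v₀‖ := by rw [norm_smul, Real.norm_eq_abs, abs_of_pos hr]
  have hux : ‖u - x₀‖ ≤ δ + r * ‖v₀‖ := by
    rw [← hrn]
    calc ‖u - x₀‖ = ‖(u - (x₀ + r • v₀)) + r • v₀‖ := by congr 1; abel
      _ ≤ _ := norm_add_le _ _
  have hup : ‖u - p‖ ≤ δ + r * ‖v₀‖ := (hp.2 x₀ hx₀).trans hux
  have hpx : ‖p - x₀‖ ≤ ε := by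
    calc ‖p - x₀‖ = ‖(u - x₀) - (u - p)‖ := by congr 1; abel
      _ ≤ ‖u - x₀‖ + ‖u - p‖ := norm_sub_le _ _
      _ ≤ ε := by linarith
  have hbp : ‖r • v₀ - (p - x₀)‖ ≤ 2 * δ + r * ‖v₀‖ := by
    calc ‖r • v₀ - (p - x₀)‖ = ‖(u - p) - (u - (x₀ + r • v₀))‖ := by congr 1; abel
      _ ≤ ‖u - p‖ + δ := norm_sub_le _ _
      _ ≤ _ := by linarith
  have hsq := pow_le_pow_left₀ (norm_nonneg _) hbp 2
  rw [norm_sub_sq_real, hrn, real_inner_smul_left] at hsq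
  have hin := mul_le_mul_of_nonneg_left (H.inner_le p hp.1 hpx) hr.le
  have hlt : (1 - r * ρ) * ‖p - x₀‖ ^ 2 < (1 - r * ρ) * η ^ 2 := by nlinarith
  exact lt_of_pow_lt_pow_left₀ 2 hη.le (lt_of_mul_lt_mul_left hlt (by linarith))

/-- The pairs made of a projection and the associated normal vector are close to `(x₀, v₀)`. -/
theorem eventually_projection_pair (H : ProxRegularWith Ω x₀ v₀ ε ρ) (hx₀ : x₀ ∈ Ω) (hr : 0 < r)
    (hrρ : r * ρ < 1) (hrv : 4 * (r * ‖v₀‖) ≤ ε) {P : E × E → Prop}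
    (hP : ∀ᶠ q in 𝓝 (x₀, v₀), P q) :
    ∀ᶠ u in 𝓝 (x₀ + r • v₀), ∀ p ∈ projection Ω u, P (p, r⁻¹ • (u - p)) := by
  have hc : Continuous fun q : E × E => (q.2, r⁻¹ • (q.1 - q.2)) := by fun_prop
  have hT := hc.tendsto (x₀ + r • v₀, x₀)
  simp only [add_sub_cancel_left, smul_smul, inv_mul_cancel₀ hr.ne', one_smul] at hT
  have h1 := hT.eventually hP
  rw [nhds_prod_eq] at h1
  obtain ⟨pa, ha, pb, hb, hab⟩ := eventually_prod_iff.1 h1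
  obtain ⟨η, hη, hη'⟩ := Metric.eventually_nhds_iff.1 hb
  filter_upwards [ha, H.eventually_projection_near hx₀ hr hrρ hrv hη] with u h2 h3 p hp
  exact hab h2 (hη' (by rw [dist_eq_norm]; exact h3 p hp))

/-- The normals at `x` and `p` differ by `-(r⁻¹ • (x - p))`, so hypomonotonicity reads `r⁻¹ * ‖x -
p‖ ^ 2 ≤ ρ * ‖x - p‖ ^ 2`. -/
theorem eq_of_mem_projection (H : ProxRegularWith Ω x₀ v₀ ε ρ) (hr : 0 < r)
    (hrρ : r * ρ < 1) {x v p : E} (hv : v ∈ normalCone Ω x)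
    (hl : ‖x - x₀‖ ^ 2 + ‖v - v₀‖ ^ 2 ≤ ε ^ 2) (hp : p ∈ projection Ω (x + r • v))
    (hpl : ‖p - x₀‖ ^ 2 + ‖r⁻¹ • (x + r • v - p) - v₀‖ ^ 2 ≤ ε ^ 2) : p = x := by
  have h1 := H.hypomonotone hv hl
    (smul_sub_mem_normalCone_of_mem_projection (inv_nonneg.2 hr.le) hp) hpl
  have h2 : v - r⁻¹ • (x + r • v - p) = -(r⁻¹ • (x - p)) := by
    rw [show x + r • v - p = (x - p) + r • v by abel, smul_add, smul_smul,
      inv_mul_cancel₀ hr.ne', one_smul]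
    abel
  rw [h2, inner_neg_left, real_inner_smul_left, real_inner_self_eq_norm_sq] at h1
  have h3 : ‖x - p‖ ^ 2 * (1 - r * ρ) ≤ 0 := by
    have h4 : r * (r⁻¹ * ‖x - p‖ ^ 2) = ‖x - p‖ ^ 2 := mul_inv_cancel_left₀ hr.ne' _
    have h5 : r * (r⁻¹ * ‖x - p‖ ^ 2) ≤ r * (ρ * ‖x - p‖ ^ 2) :=
      mul_le_mul_of_nonneg_left (by linarith) hr.le
    linarith
  have h6 : ‖x - p‖ ^ 2 = 0 := by nlinarith [sq_nonneg ‖x - p‖]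
  exact (sub_eq_zero.1 (norm_eq_zero.1 (pow_eq_zero_iff two_ne_zero |>.1 h6))).symm

/-- Projections of nearby points depend on them in a Lipschitz continuous way. -/
theorem projection_lipschitz (H : ProxRegularWith Ω x₀ v₀ ε ρ) (hr : 0 < r)
    {u₁ u₂ p₁ p₂ : E} (h₁ : p₁ ∈ projection Ω u₁) (h₂ : p₂ ∈ projection Ω u₂)
    (hl₁ : ‖p₁ - x₀‖ ^ 2 + ‖r⁻¹ • (u₁ - p₁) - v₀‖ ^ 2 ≤ ε ^ 2)
    (hl₂ : ‖p₂ - x₀‖ ^ 2 + ‖r⁻¹ • (u₂ - p₂) - v₀‖ ^ 2 ≤ ε ^ 2) :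
    (1 - r * ρ) * ‖p₁ - p₂‖ ≤ ‖u₁ - u₂‖ := by
  have h := H.hypomonotone
    (smul_sub_mem_normalCone_of_mem_projection (inv_nonneg.2 hr.le) h₁) hl₁
    (smul_sub_mem_normalCone_of_mem_projection (inv_nonneg.2 hr.le) h₂) hl₂
  rw [← smul_sub, real_inner_smul_left,
    show u₁ - p₁ - (u₂ - p₂) = (u₁ - u₂) - (p₁ - p₂) by abel, inner_sub_left,
    real_inner_self_eq_norm_sq] at h
  have h3 := mul_le_mul_of_nonneg_left h hr.le
  rw [mul_inv_cancel_left₀ hr.ne'] at h3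
  have h4 := real_inner_le_norm (u₁ - u₂) (p₁ - p₂)
  rcases (norm_nonneg (p₁ - p₂)).eq_or_lt with h0 | h0
  · rw [← h0]
    simp
  · refine le_of_mul_le_mul_right ?_ h0
    nlinarith

theorem exists_projection_map [FiniteDimensional ℝ E] (H : ProxRegularWith Ω x₀ v₀ ε ρ)
    (hcl : IsClosed Ω) (hx₀ : x₀ ∈ Ω) (hr : 0 < r) (hrρ : r * ρ < 1)
    (hrv : 4 * (r * ‖v₀‖) ≤ ε) :
    ∃ p : E → E, (∀ᶠ u in 𝓝 (x₀ + r • v₀), projection Ω u = {p u}) ∧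
      p (x₀ + r • v₀) = x₀ := by
  have hne := projection_nonempty hcl ⟨x₀, hx₀⟩
  choose p hp using hne
  have hpair := H.eventually_projection_pair hx₀ hr hrρ hrv H.eventually_local
  refine ⟨p, ?_, ?_⟩
  · filter_upwards [hpair] with u hu
    refine Subset.antisymm (fun y hy => ?_) (singleton_subset_iff.2 (hp u))
    have h1 := H.projection_lipschitz hr hy (hp u) (hu y hy) (hu _ (hp u))
    rw [sub_self, norm_zero] at h1
    have h2 : ‖y - p u‖ ≤ 0 := by
      by_contra hcon
      have := mul_pos (sub_pos.2 hrρ) (not_le.1 hcon)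
      linarith
    exact sub_eq_zero.1 (norm_le_zero_iff.1 h2)
  · exact H.eq_of_mem_projection hr hrρ H.2.2.1 (by simp [sq_nonneg]) (hp _)
      (hpair.self_of_nhds _ (hp _))

/-- Near `(x₀, v₀)`, a base point `x` with a normal vector `v` is a projection of `x + r • v`. -/
theorem eventually_mem_projection_of_mem_normalCone [FiniteDimensional ℝ E]
    (H : ProxRegularWith Ω x₀ v₀ ε ρ) (hcl : IsClosed Ω) (hx₀ : x₀ ∈ Ω) (hr : 0 < r) (hrρ : r * ρ < 1)
    (hrv : 4 * (r * ‖v₀‖) ≤ ε) :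
    ∀ᶠ q : E × E in 𝓝 (x₀, v₀), q.2 ∈ normalCone Ω q.1 →
      q.1 ∈ projection Ω (q.1 + r • q.2) := by
  have hc : Continuous fun q : E × E => q.1 + r • q.2 := by fun_prop
  have hpair := (hc.tendsto (x₀, v₀)).eventually
    (H.eventually_projection_pair hx₀ hr hrρ hrv H.eventually_local)
  filter_upwards [hpair, H.eventually_local] with q h1 h2 h3
  obtain ⟨p, hp⟩ := projection_nonempty hcl ⟨x₀, hx₀⟩ (q.1 + r • q.2)
  rwa [H.eq_of_mem_projection hr hrρ h3 h2 hp (h1 p hp)] at hp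

/-- Tangent vectors follow the linear change of coordinates between the graphs. A projection always
yields a normal; the converse holds only near `(x₀, v₀)`. -/
theorem graphicalDeriv_projection_iff [FiniteDimensional ℝ E] (H : ProxRegularWith Ω x₀ v₀ ε ρ)
    (hcl : IsClosed Ω) (hx₀ : x₀ ∈ Ω) (hr : 0 < r) (hrρ : r * ρ < 1)
    (hrv : 4 * (r * ‖v₀‖) ≤ ε) (w z : E) :
    z ∈ graphicalDeriv (projection Ω) (x₀ + r • v₀) x₀ w ↔
      r⁻¹ • (w - z) ∈ graphicalDeriv (normalCone Ω) x₀ v₀ z := by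
  change (w, z) ∈ tangentCone _ _ ↔ (z, r⁻¹ • (w - z)) ∈ tangentCone _ _
  rw [tangentCone_eq_outerLimit, tangentCone_eq_outerLimit]
  constructor
  · intro h
    have hc : Continuous fun q : E × E => (q.2, r⁻¹ • (q.1 - q.2)) := by fun_prop
    have hT : Tendsto (fun y : ℝ × (E × E) => (y.1, (y.2.2, r⁻¹ • (y.2.1 - y.2.2))))
        (𝓝[>] 0 ×ˢ 𝓝 (w, z)) (𝓝[>] 0 ×ˢ 𝓝 (z, r⁻¹ • (w - z))) :=
      tendsto_fst.prodMk ((hc.tendsto (w, z)).comp tendsto_snd)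
    refine Tendsto.frequently
      (p := fun y : ℝ × (E × E) => (x₀, v₀) + y.1 • y.2 ∈ graph (normalCone Ω)) hT ?_
    refine Frequently.mono h ?_
    rintro ⟨t, u, y⟩ hy
    have h1 := smul_sub_mem_normalCone_of_mem_projection (inv_nonneg.2 hr.le) (c := r⁻¹) hy
    simp only [graph, Prod.smul_mk, Prod.mk_add_mk, mem_ofPred_eq] at h1 ⊢
    convert h1 using 1
    rw [show x₀ + r • v₀ + t • u - (x₀ + t • y) = r • v₀ + t • (u - y) by
      rw [smul_sub]; abel, smul_add, smul_smul, smul_smul, smul_smul, inv_mul_cancel₀ hr.ne',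
      one_smul, mul_comm]
  · intro h
    have hc : Continuous fun q : E × E => (q.1 + r • q.2, q.1) := by fun_prop
    have hT : Tendsto (fun y : ℝ × (E × E) => (y.1, (y.2.1 + r • y.2.2, y.2.1)))
        (𝓝[>] 0 ×ˢ 𝓝 (z, r⁻¹ • (w - z))) (𝓝[>] 0 ×ˢ 𝓝 (w, z)) := by
      have h1 := hc.tendsto (z, r⁻¹ • (w - z))
      simp only [smul_smul, mul_inv_cancel₀ hr.ne', one_smul, add_sub_cancel] at h1
      exact tendsto_fst.prodMk (h1.comp tendsto_snd)
    refine Tendsto.frequently (p := fun y : ℝ × (E × E) =>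
      (x₀ + r • v₀, x₀) + y.1 • y.2 ∈ graph (projection Ω)) hT ?_
    have hS : Tendsto (fun y : ℝ × (E × E) => (x₀, v₀) + y.1 • y.2)
        (𝓝[>] 0 ×ˢ 𝓝 (z, r⁻¹ • (w - z))) (𝓝 (x₀, v₀)) := by
      have h1 : Continuous fun y : ℝ × (E × E) => (x₀, v₀) + y.1 • y.2 := by fun_prop
      have h2 := h1.tendsto (0, (z, r⁻¹ • (w - z)))
      rw [zero_smul, add_zero, nhds_prod_eq] at h2
      exact h2.mono_left (prod_mono nhdsWithin_le_nhds le_rfl)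
    refine ((show ∃ᶠ y : ℝ × (E × E) in _, _ from h).and_eventually
      (hS.eventually (H.eventually_mem_projection_of_mem_normalCone hcl hx₀ hr hrρ hrv))).mono ?_
    rintro ⟨t, y, u⟩ ⟨h1, h2⟩
    have h3 := h2 h1
    simp only [graph, Prod.smul_mk, Prod.mk_add_mk, mem_ofPred_eq] at h3 ⊢
    convert h3 using 2
    simp only [smul_add, smul_smul, mul_comm]
    abel

end ProxRegularWith

/-! ### Proximal subgradients with a uniform modulus -/

/-- `y` is a proximal subgradient at `z`, with the global modulus `ρ`, of the function whose
epigraph is `G`. -/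
def IsProxSubgradient (G : Set (E × ℝ)) (ρ : ℝ) (z y : E) : Prop :=
  ∃ b, (z, b) ∈ G ∧ ∀ q ∈ G, b + ⟪y, q.1 - z⟫ - ρ / 2 * ‖q.1 - z‖ ^ 2 ≤ q.2

/-- Adding the two inequalities, each tested at the other point, gives `r⁻¹ * ‖z₁ - z₂‖ ^ 2 ≤ ρ *
‖z₁ - z₂‖ ^ 2`. -/
theorem IsProxSubgradient.resolvent_unique {G : Set (E × ℝ)} {ρ r : ℝ} {w z₁ z₂ : E} (hr : 0 < r)
    (hrρ : r * ρ < 1) (h₁ : IsProxSubgradient G ρ z₁ (r⁻¹ • (w - z₁)))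
    (h₂ : IsProxSubgradient G ρ z₂ (r⁻¹ • (w - z₂))) : z₁ = z₂ := by
  obtain ⟨b₁, hb₁, hs₁⟩ := h₁
  obtain ⟨b₂, hb₂, hs₂⟩ := h₂
  have a₁ := hs₁ _ hb₂
  have a₂ := hs₂ _ hb₁
  simp only [real_inner_smul_left] at a₁ a₂
  rw [norm_sub_rev, ← neg_sub z₁ z₂, inner_neg_right] at a₁
  have h3 : ⟪w - z₂, z₁ - z₂⟫ - ⟪w - z₁, z₁ - z₂⟫ = ‖z₁ - z₂‖ ^ 2 := by
    rw [← inner_sub_left, sub_sub_sub_cancel_left, real_inner_self_eq_norm_sq]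
  have h4 : r⁻¹ * ‖z₁ - z₂‖ ^ 2 ≤ ρ * ‖z₁ - z₂‖ ^ 2 := by
    rw [← h3, mul_sub, h3]
    linarith
  have h5 := mul_le_mul_of_nonneg_left h4 hr.le
  rw [mul_inv_cancel_left₀ hr.ne'] at h5
  have h6 : ‖z₁ - z₂‖ ^ 2 = 0 := by nlinarith [sq_nonneg ‖z₁ - z₂‖]
  exact sub_eq_zero.1 (norm_eq_zero.1 (pow_eq_zero_iff two_ne_zero |>.1 h6))

/-! ### Limits of difference quotients of the projection -/

namespace ProxRegularWith

variable {Ω : Set E} {x₀ v₀ : E} {ε ρ r : ℝ}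

/-- The difference quotients of the projection satisfy the subgradient inequality for the
second-order difference quotients of the indicator function. -/
theorem quotient_inequality (H : ProxRegularWith Ω x₀ v₀ ε ρ) (hr : 0 < r) {t : ℝ} (ht : 0 < t)
    {u q : E} (hq : x₀ + t • q ∈ projection Ω (x₀ + r • v₀ + t • u))
    (hl : ‖(x₀ + t • q) - x₀‖ ^ 2 +
      ‖r⁻¹ • ((x₀ + r • v₀ + t • u) - (x₀ + t • q)) - v₀‖ ^ 2 ≤ ε ^ 2)
    {s : E × ℝ} (hs : s ∈ quotEpi Ω x₀ v₀ t) (hsε : ‖t • s.1‖ ≤ ε) :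
    -⟪v₀, q⟫ / t + ⟪r⁻¹ • (u - q), s.1 - q⟫ - ρ / 2 * ‖s.1 - q‖ ^ 2 ≤ s.2 := by
  have h1 := H.2.2.2 _ _ _ (smul_sub_mem_normalCone_of_mem_projection (inv_nonneg.2 hr.le) hq) hl
    hs.1 (by simpa using hsε)
  -- The normal at the projection is `v₀` plus a term of order `t`, so both sides of the inequality
  -- scale like `t ^ 2`.
  have h2 : r⁻¹ • ((x₀ + r • v₀ + t • u) - (x₀ + t • q)) = v₀ + t • r⁻¹ • (u - q) := by
    rw [show x₀ + r • v₀ + t • u - (x₀ + t • q) = r • v₀ + t • (u - q) by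
      rw [smul_sub]; abel, smul_add, smul_smul, smul_smul, smul_smul, inv_mul_cancel₀ hr.ne',
      one_smul, mul_comm]
  have h3 : x₀ + t • s.1 - (x₀ + t • q) = t • (s.1 - q) := by
    rw [smul_sub]
    abel
  rw [h2, h3, inner_add_left, inner_smul_right, real_inner_smul_left, inner_smul_right,
    norm_smul, mul_pow, Real.norm_eq_abs, sq_abs, inner_sub_right] at h1
  have h4 := (div_le_iff₀ ht).1 hs.2
  have h5 : t * (-⟪v₀, q⟫ + t * ⟪r⁻¹ • (u - q), s.1 - q⟫ - t * (ρ / 2 * ‖s.1 - q‖ ^ 2)) ≤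
      t * (s.2 * t) := by nlinarith
  have h6 := le_of_mul_le_mul_left h5 ht
  have h7 : -⟪v₀, q⟫ / t * t = -⟪v₀, q⟫ := div_mul_cancel₀ _ ht.ne'
  refine le_of_mul_le_mul_right ?_ ht
  linarith

/-- Bounded quotients converge along an ultrafilter. Uniqueness of the resolvent then makes the
limit independent of `F`, which is full convergence. -/
theorem exists_limit_ultrafilter [FiniteDimensional ℝ E] (H : ProxRegularWith Ω x₀ v₀ ε ρ)
    (hx₀ : x₀ ∈ Ω) (hr : 0 < r) (hrρ : r * ρ < 1) (hrv : 4 * (r * ‖v₀‖) ≤ ε)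
    (hrec : ∀ p ∈ limEpi Ω x₀ v₀, ∃ q : ℝ → E × ℝ,
      (∀ᶠ t in 𝓝[>] 0, q t ∈ quotEpi Ω x₀ v₀ t) ∧ Tendsto q (𝓝[>] 0) (𝓝 p))
    {p : E → E} (hp : ∀ᶠ u in 𝓝 (x₀ + r • v₀), projection Ω u = {p u})
    (hp₀ : p (x₀ + r • v₀) = x₀) (w : E) (F : Ultrafilter (ℝ × E))
    (hF : (F : Filter (ℝ × E)) ≤ 𝓝[>] 0 ×ˢ 𝓝 w) :
    ∃ z, IsProxSubgradient (limEpi Ω x₀ v₀) ρ z (r⁻¹ • (w - z)) ∧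
      Tendsto (fun y : ℝ × E => y.1⁻¹ • (p (x₀ + r • v₀ + y.1 • y.2) - p (x₀ + r • v₀)))
        F (𝓝 z) := by
  have : ProperSpace E := FiniteDimensional.proper ℝ E
  rw [hp₀]
  set q : ℝ × E → E := fun y => y.1⁻¹ • (p (x₀ + r • v₀ + y.1 • y.2) - x₀) with hq
  have hF1 : Tendsto (fun y : ℝ × E => y.1) F (𝓝[>] 0) := tendsto_fst.mono_left hF
  have hF1' : Tendsto (fun y : ℝ × E => y.1) F (𝓝 0) := hF1.mono_right nhdsWithin_le_nhds
  have hF2 : Tendsto (fun y : ℝ × E => y.2) F (𝓝 w) := tendsto_snd.mono_left hF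
  have hpos : ∀ᶠ y in (F : Filter (ℝ × E)), 0 < y.1 := hF1.eventually self_mem_nhdsWithin
  have hu : Tendsto (fun y : ℝ × E => x₀ + r • v₀ + y.1 • y.2) F (𝓝 (x₀ + r • v₀)) := by
    simpa using (hF1'.smul hF2).const_add (x₀ + r • v₀)
  have hpq : ∀ᶠ y in (F : Filter (ℝ × E)), x₀ + y.1 • q y = p (x₀ + r • v₀ + y.1 • y.2) := by
    filter_upwards [hpos] with y hy
    rw [hq]
    simp only [smul_smul, mul_inv_cancel₀ hy.ne', one_smul, add_sub_cancel]
  have hproj : ∀ᶠ y in (F : Filter (ℝ × E)),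
      x₀ + y.1 • q y ∈ projection Ω (x₀ + r • v₀ + y.1 • y.2) := by
    filter_upwards [hu.eventually hp, hpq] with y h1 h2
    rw [h1, h2]
    exact mem_singleton _
  have hlocal := H.eventually_projection_pair hx₀ hr hrρ hrv H.eventually_local
  have hlocF : ∀ᶠ y in (F : Filter (ℝ × E)), ‖(x₀ + y.1 • q y) - x₀‖ ^ 2 +
      ‖r⁻¹ • ((x₀ + r • v₀ + y.1 • y.2) - (x₀ + y.1 • q y)) - v₀‖ ^ 2 ≤ ε ^ 2 := by
    filter_upwards [hu.eventually hlocal, hproj] with y h1 h2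
    exact h1 _ h2
  have hx₀p : x₀ ∈ projection Ω (x₀ + r • v₀) := by
    rw [hp.self_of_nhds, hp₀]
    exact mem_singleton _
  have hκ : 0 < 1 - r * ρ := by linarith
  have hbd : ∀ᶠ y in (F : Filter (ℝ × E)),
      q y ∈ Metric.closedBall (0 : E) ((‖w‖ + 1) / (1 - r * ρ)) := by
    filter_upwards [hpos, hproj, hlocF, hF2.norm.eventually (gt_mem_nhds (lt_add_one ‖w‖))]
      with y h1 h2 h3 h4
    have h5 := H.projection_lipschitz hr h2 hx₀p h3 (hlocal.self_of_nhds _ hx₀p)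
    rw [add_sub_cancel_left, add_sub_cancel_left, norm_smul _ (q y), norm_smul _ y.2,
      mul_left_comm] at h5
    have h6 := le_of_mul_le_mul_left h5 (norm_pos_iff.2 h1.ne')
    rw [mem_closedBall_zero_iff, le_div_iff₀ hκ]
    linarith
  obtain ⟨z, -, hz⟩ := (isCompact_closedBall (0 : E) _).ultrafilter_le_nhds' (F.map q) hbd
  have hqz : Tendsto q F (𝓝 z) := hz
  set b : ℝ × E → ℝ := fun y => -⟪v₀, q y⟫ / y.1 with hb
  have hineq : ∀ᶠ y in (F : Filter (ℝ × E)), ∀ s ∈ quotEpi Ω x₀ v₀ y.1, ‖y.1 • s.1‖ ≤ ε →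
      b y + ⟪r⁻¹ • (y.2 - q y), s.1 - q y⟫ - ρ / 2 * ‖s.1 - q y‖ ^ 2 ≤ s.2 := by
    filter_upwards [hpos, hproj, hlocF] with y h1 h2 h3 s hs hsε
    exact H.quotient_inequality hr h1 h2 h3 hs hsε
  have hslope : Tendsto (fun y : ℝ × E => r⁻¹ • (y.2 - q y)) F (𝓝 (r⁻¹ • (w - z))) :=
    (hF2.sub hqz).const_smul _
  have hup : ∀ᶠ y in (F : Filter (ℝ × E)), b y ≤ ⟪r⁻¹ • (w - z), z⟫ + ρ / 2 * ‖z‖ ^ 2 + 1 := by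
    have hT : Tendsto (fun y : ℝ × E => ⟪r⁻¹ • (y.2 - q y), q y⟫ + ρ / 2 * ‖q y‖ ^ 2) F
        (𝓝 (⟪r⁻¹ • (w - z), z⟫ + ρ / 2 * ‖z‖ ^ 2)) :=
      (hslope.inner hqz).add ((hqz.norm.pow 2).const_mul _)
    filter_upwards [hineq, hT.eventually (gt_mem_nhds (lt_add_one _))] with y h1 h2
    -- Testing at the origin, admissible because `x₀ ∈ Ω`, bounds the heights `b` from above.
    have h3 := h1 (0, 0) (by simp [quotEpi, hx₀]) (by simpa using H.1.le)
    simp only [zero_sub, inner_neg_right, norm_neg] at h3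
    linarith
  have hdown : ∀ᶠ y in (F : Filter (ℝ × E)), -(ρ / 2 * ‖z‖ ^ 2) - 1 ≤ b y := by
    have hT : Tendsto (fun y : ℝ × E => -(ρ / 2 * ‖q y‖ ^ 2)) F (𝓝 (-(ρ / 2 * ‖z‖ ^ 2))) :=
      ((hqz.norm.pow 2).const_mul _).neg
    filter_upwards [hpos, hproj, hlocF, hT.eventually (lt_mem_nhds (sub_one_lt _))]
      with y h1 h2 h3 h4
    have h5 := H.inner_le _ h2.1 (H.norm_le_of_local h3)
    rw [add_sub_cancel_left, inner_smul_right, norm_smul, mul_pow, Real.norm_eq_abs,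
      sq_abs] at h5
    have h6 : y.1 * ⟪v₀, q y⟫ ≤ y.1 * (ρ / 2 * ‖q y‖ ^ 2 * y.1) := by linarith
    have h7 := le_of_mul_le_mul_left h6 h1
    refine h4.le.trans ((le_div_iff₀ h1).2 ?_)
    linarith
  obtain ⟨β, -, hβ⟩ := (isCompact_Icc).ultrafilter_le_nhds' (F.map b)
    (show ∀ᶠ y in (F : Filter (ℝ × E)), b y ∈ Icc _ _ from hdown.and hup)
  have hbβ : Tendsto b F (𝓝 β) := hβ
  refine ⟨z, ⟨β, ?_, fun s hs => ?_⟩, hqz⟩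
  · refine mem_outerLimit_of_tendsto hF1 (hqz.prodMk_nhds hbβ) ?_
    filter_upwards [hproj] with y hy
    exact ⟨hy.1, le_rfl⟩
  -- An arbitrary point of the limit epigraph is reached for all small `t`, so the inequality can be
  -- tested there along `F`.
  · obtain ⟨c, hc, hcs⟩ := hrec s hs
    have hcF : Tendsto (fun y : ℝ × E => c y.1) F (𝓝 s) := hcs.comp hF1
    have hc1 : Tendsto (fun y : ℝ × E => (c y.1).1) F (𝓝 s.1) :=
      (continuous_fst.tendsto _).comp hcF
    have hc2 : Tendsto (fun y : ℝ × E => (c y.1).2) F (𝓝 s.2) :=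
      (continuous_snd.tendsto _).comp hcF
    have hsmall : Tendsto (fun y : ℝ × E => ‖y.1 • (c y.1).1‖) F (𝓝 0) := by
      simpa using (hF1'.smul hc1).norm
    refine le_of_tendsto_of_tendsto ((hbβ.add (hslope.inner (hc1.sub hqz))).sub
      (((hc1.sub hqz).norm.pow 2).const_mul (ρ / 2))) hc2 ?_
    filter_upwards [hineq, hF1.eventually hc, hsmall.eventually (gt_mem_nhds H.1)] with y h1 h2 h3
    exact h1 _ h2 h3.le

/-- The projection is semidifferentiable; its semiderivative is the resolvent of the proximal
subgradient mapping of one half of the second subderivative. -/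
theorem exists_hasSemiderivAt [FiniteDimensional ℝ E] (H : ProxRegularWith Ω x₀ v₀ ε ρ)
    (hx₀ : x₀ ∈ Ω) (hr : 0 < r) (hrρ : r * ρ < 1) (hrv : 4 * (r * ‖v₀‖) ≤ ε)
    (hrec : ∀ p ∈ limEpi Ω x₀ v₀, ∃ q : ℝ → E × ℝ,
      (∀ᶠ t in 𝓝[>] 0, q t ∈ quotEpi Ω x₀ v₀ t) ∧ Tendsto q (𝓝[>] 0) (𝓝 p))
    {p : E → E} (hp : ∀ᶠ u in 𝓝 (x₀ + r • v₀), projection Ω u = {p u})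
    (hp₀ : p (x₀ + r • v₀) = x₀) :
    ∃ D : E → E, HasSemiderivAt p D (x₀ + r • v₀) ∧
      ∀ w, IsProxSubgradient (limEpi Ω x₀ v₀) ρ (D w) (r⁻¹ • (w - D w)) := by
  have hlim := H.exists_limit_ultrafilter hx₀ hr hrρ hrv hrec hp hp₀
  have hex : ∀ w, ∃ z, IsProxSubgradient (limEpi Ω x₀ v₀) ρ z (r⁻¹ • (w - z)) := fun w => by
    obtain ⟨z, hz, -⟩ := hlim w (Ultrafilter.of (𝓝[>] 0 ×ˢ 𝓝 w)) (Ultrafilter.of_le _)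
    exact ⟨z, hz⟩
  choose D hD using hex
  refine ⟨D, fun w => ?_, hD⟩
  rw [tendsto_iff_ultrafilter]
  intro F hF
  obtain ⟨z, hz, hT⟩ := hlim w F hF
  rwa [hz.resolvent_unique hr hrρ (hD w)] at hT

end ProxRegularWith

/-! ### Graphical derivatives of single-valued mappings -/

theorem graphicalDeriv_eq_singleton_of_hasSemiderivAt {S : E → Set E} {p D : E → E} {u : E}
    (hS : ∀ᶠ y in 𝓝 u, S y = {p y}) (hD : HasSemiderivAt p D u) (w : E) :
    graphicalDeriv S u (p u) w = {D w} := by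
  have hnear : ∀ w', Tendsto (fun y : ℝ × E => u + y.1 • y.2) (𝓝[>] 0 ×ˢ 𝓝 w') (𝓝 u) :=
    fun w' => by
      have h1 : Continuous fun y : ℝ × E => u + y.1 • y.2 := by fun_prop
      have h2 := h1.tendsto (0, w')
      rw [zero_smul, add_zero, nhds_prod_eq] at h2
      exact h2.mono_left (prod_mono nhdsWithin_le_nhds le_rfl)
  ext z
  rw [mem_singleton_iff]
  constructor
  · rintro ⟨t, y, ht, ht0, hy, hmem⟩
    have hy1 := (continuous_fst.tendsto _).comp hy
    have hy2 := (continuous_snd.tendsto _).comp hy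
    have hty : Tendsto (fun k => (t k, (y k).1)) atTop (𝓝[>] 0 ×ˢ 𝓝 w) :=
      (tendsto_nhdsWithin_iff.2 ⟨ht0, Eventually.of_forall ht⟩).prodMk hy1
    refine tendsto_nhds_unique (hy2.congr' ?_) ((hD w).comp hty)
    filter_upwards [((hnear w).comp hty).eventually hS] with k hk
    have h1 : p u + t k • (y k).2 ∈ S (u + t k • (y k).1) := hmem k
    rw [show S (u + t k • (y k).1) = {p (u + t k • (y k).1)} from hk, mem_singleton_iff] at h1
    simp only [Function.comp_apply, ← h1, add_sub_cancel_left, smul_smul,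
      inv_mul_cancel₀ (ht k).ne', one_smul]
  · rintro rfl
    change (w, D w) ∈ tangentCone _ _
    rw [tangentCone_eq_outerLimit]
    have hty : Tendsto (fun t : ℝ => (t, w)) (𝓝[>] 0) (𝓝[>] 0 ×ˢ 𝓝 w) :=
      tendsto_id.prodMk tendsto_const_nhds
    refine mem_outerLimit_of_tendsto tendsto_id
      (tendsto_const_nhds.prodMk_nhds ((hD w).comp hty)) ?_
    filter_upwards [((hnear w).comp hty).eventually hS, self_mem_nhdsWithin] with t h1 h2
    have h3 : t ≠ 0 := ne_of_gt h2
    simp only [graph, mem_ofPred_eq, id, Prod.smul_mk, Prod.mk_add_mk, Function.comp_apply,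
      smul_smul, mul_inv_cancel₀ h3, one_smul, add_sub_cancel] at h1 ⊢
    rw [h1]
    exact mem_singleton _

theorem ProxRegularWith.protoDifferentiable [FiniteDimensional ℝ E] {Ω : Set E} {x₀ v₀ : E}
    {ε ρ r : ℝ} (H : ProxRegularWith Ω x₀ v₀ ε ρ)
    (hcl : IsClosed Ω) (hx₀ : x₀ ∈ Ω) (hr : 0 < r) (hrρ : r * ρ < 1)
    (hrv : 4 * (r * ‖v₀‖) ≤ ε) {p D : E → E}
    (hp : ∀ᶠ u in 𝓝 (x₀ + r • v₀), projection Ω u = {p u})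
    (hp₀ : p (x₀ + r • v₀) = x₀) (hD : HasSemiderivAt p D (x₀ + r • v₀)) :
    ProtoDifferentiable (normalCone Ω) x₀ v₀ := by
  rintro ⟨z, y⟩ hzy
  set w := z + r • y with hw
  have hy : r⁻¹ • (w - z) = y := by
    rw [hw, add_sub_cancel_left, smul_smul, inv_mul_cancel₀ hr.ne', one_smul]
  have hz : z = D w := by
    have h1 : r⁻¹ • (w - z) ∈ graphicalDeriv (normalCone Ω) x₀ v₀ z := by
      rw [hy]
      exact hzy
    rw [← H.graphicalDeriv_projection_iff hcl hx₀ hr hrρ hrv] at h1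
    have h2 := graphicalDeriv_eq_singleton_of_hasSemiderivAt hp hD w
    rw [hp₀] at h2
    rwa [h2] at h1
  have hc : Tendsto (fun t : ℝ => x₀ + r • v₀ + t • w) (𝓝 0) (𝓝 (x₀ + r • v₀)) := by
    have : Continuous fun t : ℝ => x₀ + r • v₀ + t • w := by fun_prop
    simpa using this.tendsto 0
  obtain ⟨η, hη, hη'⟩ := Metric.eventually_nhds_iff.1 (hc.eventually hp)
  -- The arc is the image of the segment `x₀ + r • v₀ + t • w` under the change of coordinates; `η /
  -- 2` keeps the closed interval inside the open ball.
  refine ⟨η / 2, half_pos hη, fun t => (p (x₀ + r • v₀ + t • w),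
    r⁻¹ • (x₀ + r • v₀ + t • w - p (x₀ + r • v₀ + t • w))), fun t ht => ?_, ?_, ?_⟩
  · refine smul_sub_mem_normalCone_of_mem_projection (inv_nonneg.2 hr.le) ?_
    rw [hη' (y := t) (by rw [Real.dist_0_eq_abs, abs_of_nonneg ht.1]; linarith [ht.2])]
    exact mem_singleton _
  · simp [hp₀, smul_smul, hr.ne']
  · have hty : Tendsto (fun t : ℝ => (t, w)) (𝓝[>] 0) (𝓝[>] 0 ×ˢ 𝓝 w) :=
      tendsto_id.prodMk tendsto_const_nhds
    have h1 := (hD w).comp hty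
    rw [← hz] at h1
    have h2 := h1.prodMk_nhds ((tendsto_const_nhds (x := w).sub h1).const_smul r⁻¹)
    rw [hy] at h2
    refine h2.congr' ?_
    filter_upwards [self_mem_nhdsWithin] with t ht
    have ht' : t ≠ 0 := ne_of_gt ht
    simp only [Function.comp_apply, zero_smul, add_zero, Prod.mk_sub_mk, Prod.smul_mk]
    congr 1
    rw [← smul_sub, smul_comm t⁻¹ r⁻¹, show x₀ + r • v₀ + t • w - p (x₀ + r • v₀ + t • w) -
      (x₀ + r • v₀ - p (x₀ + r • v₀)) = t • w - (p (x₀ + r • v₀ + t • w) - p (x₀ + r • v₀)) by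
        abel, smul_sub t⁻¹ (t • w), smul_smul t⁻¹ t, inv_mul_cancel₀ ht', one_smul]

/-! ### Proximal and limiting subgradients -/

theorem limEpi_upward {Ω : Set E} {x v w : E} {a a' : ℝ} (h : (w, a) ∈ limEpi Ω x v)
    (ha : a ≤ a') : (w, a') ∈ limEpi Ω x v := by
  obtain ⟨t, q, ht, ht0, hq, hmem⟩ := mem_outerLimit_iff_seq.1 h
  refine mem_outerLimit_iff_seq.2 ⟨t, fun k => ((q k).1, (q k).2 + (a' - a)), ht, ht0, ?_,
    fun k => ⟨(hmem k).1, (hmem k).2.trans (by simpa using ha)⟩⟩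
  refine ((continuous_fst.tendsto _).comp hq).prodMk_nhds ?_
  simpa using ((continuous_snd.tendsto _).comp hq).add_const (a' - a)

theorem norm_sq_convex_combination (d c : E) (s : ℝ) :
    (1 - s) * ‖d - s • c‖ ^ 2 + s * ‖d + (1 - s) • c‖ ^ 2 =
      ‖d‖ ^ 2 + s * (1 - s) * ‖c‖ ^ 2 := by
  rw [norm_sub_sq_real, norm_add_sq_real, inner_smul_right, inner_smul_right, norm_smul,
    norm_smul, mul_pow, mul_pow, Real.norm_eq_abs, Real.norm_eq_abs, sq_abs, sq_abs]
  ring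

/-- A closed epigraph whose proximal subgradient mapping has full resolvents for all small
parameters becomes convex after adding `ρ / 2 * ‖·‖ ^ 2`. -/
theorem hypoconvex_of_resolvents {G : Set (E × ℝ)} {ρ r₀ : ℝ} (hρ : 0 < ρ) (hr₀ : 0 < r₀)
    (hcl : IsClosed G) (hup : ∀ w a a', (w, a) ∈ G → a ≤ a' → (w, a') ∈ G)
    (hlow : ∀ w a, (w, a) ∈ G → -(ρ / 2 * ‖w‖ ^ 2) ≤ a)
    (hex : ∀ r, 0 < r → r < r₀ → ∀ w, ∃ z, IsProxSubgradient G ρ z (r⁻¹ • (w - z)))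
    {a b : E} {α β s : ℝ} (ha : (a, α) ∈ G) (hb : (b, β) ∈ G) (hs0 : 0 ≤ s) (hs1 : s ≤ 1) :
    (a + s • (b - a), (1 - s) * α + s * β + ρ / 2 * (s * (1 - s) * ‖b - a‖ ^ 2)) ∈ G := by
  set m := a + s • (b - a) with hm
  set M := (1 - s) * α + s * β + ρ / 2 * (s * (1 - s) * ‖b - a‖ ^ 2) with hM
  -- The resolvent point `z` of `m` tends to `m` as `r ↓ 0` at height at most `M`. Combining its
  -- inequalities at `a` and `b` with weights `1 - s` and `s` cancels the cross terms; `3 * (r * ρ)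
  -- < 1` absorbs the quadratic errors into half of `r⁻¹ * ‖m - z‖ ^ 2`.
  have hkey : ∀ r, 0 < r → r < r₀ → 3 * (r * ρ) < 1 →
      ∃ z, (z, M) ∈ G ∧ ‖z - m‖ ^ 2 ≤ 2 * r * (M + ρ * ‖m‖ ^ 2) := by
    intro r hr hrr hrρ
    obtain ⟨z, c, hc, hsub⟩ := hex r hr hrr m
    have h1 := hsub _ ha
    have h2 := hsub _ hb
    have e1 : a - z = (m - z) - s • (b - a) := by rw [hm]; abel
    have e2 : b - z = (m - z) + (1 - s) • (b - a) := by
      rw [hm, sub_smul, one_smul]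
      abel
    simp only [real_inner_smul_left] at h1 h2
    rw [e1, inner_sub_right, inner_smul_right, real_inner_self_eq_norm_sq] at h1
    rw [e2, inner_add_right, inner_smul_right, real_inner_self_eq_norm_sq] at h2
    have h3 := norm_sq_convex_combination (m - z) (b - a) s
    have h4 := add_le_add (mul_le_mul_of_nonneg_left h1 (sub_nonneg.2 hs1))
      (mul_le_mul_of_nonneg_left h2 hs0)
    have h5 : c + r⁻¹ * ‖m - z‖ ^ 2 - ρ / 2 * ‖m - z‖ ^ 2 ≤ M := by
      rw [hM]
      linear_combination h4 + (ρ / 2) * h3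
    have h6 := hlow z c hc
    have h7 : ‖z‖ ^ 2 ≤ 2 * (‖m‖ ^ 2 + ‖m - z‖ ^ 2) := by
      have := norm_sub_sq_real m (m - z)
      rw [sub_sub_cancel] at this
      have h8 := norm_add_sq_real m (m - z)
      nlinarith [sq_nonneg ‖m + (m - z)‖]
    have h9 : 3 * ρ < r⁻¹ := by
      rw [lt_inv_comm₀ (by positivity) hr, ← one_div, lt_div_iff₀ (by positivity)]
      linarith
    have hn := sq_nonneg ‖m - z‖
    have h10 := mul_le_mul_of_nonneg_right h9.le hn
    refine ⟨z, hup _ _ _ hc ?_, ?_⟩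
    · have := mul_nonneg hρ.le hn
      linarith
    · have h11 := mul_le_mul_of_nonneg_left h7 hρ.le
      have h12 : r⁻¹ * ‖m - z‖ ^ 2 ≤ 2 * (M + ρ * ‖m‖ ^ 2) := by linarith
      have h13 := mul_le_mul_of_nonneg_left h12 hr.le
      rw [mul_inv_cancel_left₀ hr.ne'] at h13
      rw [norm_sub_rev]
      linarith
  choose! z hz hzm using hkey
  have hpos : ∀ᶠ r : ℝ in 𝓝[>] 0, 0 < r := self_mem_nhdsWithin
  have hlt : ∀ᶠ r : ℝ in 𝓝[>] 0, r < r₀ := mem_nhdsWithin_of_mem_nhds (Iio_mem_nhds hr₀)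
  have hT : ∀ c : ℝ, Tendsto (fun r : ℝ => c * r) (𝓝[>] 0) (𝓝 0) := fun c => by
    have : Continuous fun r : ℝ => c * r := by fun_prop
    simpa using (this.tendsto 0).mono_left nhdsWithin_le_nhds
  have hsm : ∀ᶠ r : ℝ in 𝓝[>] 0, 3 * (r * ρ) < 1 := by
    filter_upwards [(hT (3 * ρ)).eventually (gt_mem_nhds one_pos)] with r hr
    linarith
  have hzlim : Tendsto z (𝓝[>] 0) (𝓝 m) := by
    rw [tendsto_iff_norm_sub_tendsto_zero]
    have h1 : Tendsto (fun r => ‖z r - m‖ ^ 2) (𝓝[>] 0) (𝓝 0) := by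
      refine squeeze_zero' (Eventually.of_forall fun r => sq_nonneg _) ?_
        (hT (2 * (M + ρ * ‖m‖ ^ 2)))
      filter_upwards [hpos, hlt, hsm] with r h1 h2 h3
      linarith [hzm r h1 h2 h3]
    simpa using h1.sqrt
  refine hcl.mem_of_tendsto (hzlim.prodMk_nhds tendsto_const_nhds) ?_
  filter_upwards [hpos, hlt, hsm] with r h1 h2 h3
  exact hz r h1 h2 h3

theorem inner_toLp_fst_snd (V W : WithLp 2 (E × ℝ)) :
    ⟪V, W⟫ = ⟪V.fst, W.fst⟫ + V.snd * W.snd := by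
  rw [WithLp.prod_inner_apply]
  simp [mul_comm]

/-- For a hypoconvex function, regular normals to the epigraph satisfy a global quadratic
inequality. -/
theorem inner_le_of_mem_regularNormalCone_epigraph {φ : E → EReal} {ρ : ℝ}
    (hconv : ∀ (a b : E) (α β s : ℝ), φ a ≤ α → φ b ≤ β → 0 ≤ s → s ≤ 1 →
      φ (a + s • (b - a)) ≤
        (((1 - s) * α + s * β + ρ / 2 * (s * (1 - s) * ‖b - a‖ ^ 2) : ℝ) : EReal))
    {Q V : WithLp 2 (E × ℝ)} (hV : V ∈ regularNormalCone (epigraph φ) Q) {b : E} {β : ℝ}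
    (hb : φ b ≤ β) :
    ⟪V.fst, b - Q.fst⟫ + V.snd * (β - Q.snd + ρ / 2 * ‖b - Q.fst‖ ^ 2) ≤ 0 := by
  -- By hypoconvexity `Q + s • R s` stays in the epigraph for small `s > 0`; regular normality then
  -- gives `⟪V, R 0⟫ ≤ 0`, which is the claim.
  set R : ℝ → WithLp 2 (E × ℝ) := fun s => WithLp.toLp 2
    (b - Q.fst, β - Q.snd + ρ / 2 * ((1 - s) * ‖b - Q.fst‖ ^ 2)) with hR
  have hRc : Continuous R := by
    refine (WithLp.prod_continuous_toLp 2 E ℝ).comp ?_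
    fun_prop
  have hR0 : Tendsto R (𝓝[>] 0) (𝓝 (R 0)) := (hRc.tendsto 0).mono_left nhdsWithin_le_nhds
  have hpos : ∀ᶠ s : ℝ in 𝓝[>] 0, 0 < s := self_mem_nhdsWithin
  have hmem : ∀ᶠ s : ℝ in 𝓝[>] 0, Q + s • R s ∈ epigraph φ := by
    filter_upwards [hpos, mem_nhdsWithin_of_mem_nhds (Iic_mem_nhds one_pos)] with s h1 h2
    have h3 := hconv Q.fst b Q.snd β s hV.1 hb h1.le h2
    refine h3.trans_eq ?_
    congr 1
    rw [WithLp.add_snd, WithLp.smul_snd, smul_eq_mul]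
    change _ = Q.snd + s * (β - Q.snd + ρ / 2 * ((1 - s) * ‖b - Q.fst‖ ^ 2))
    ring
  have hT : Tendsto (fun s => Q + s • R s) (𝓝[>] 0) (𝓝[epigraph φ] Q) := by
    refine tendsto_nhdsWithin_iff.2 ⟨?_, hmem⟩
    have h1 : Continuous fun s : ℝ => Q + s • R s := by fun_prop
    have h2 := h1.tendsto 0
    rw [zero_smul, add_zero] at h2
    exact h2.mono_left nhdsWithin_le_nhds
  have hfin : ∀ ε > (0 : ℝ), ⟪V, R 0⟫ ≤ ε * ‖R 0‖ := by
    intro ε hε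
    refine le_of_tendsto_of_tendsto (tendsto_const_nhds.inner hR0) (hR0.norm.const_mul ε) ?_
    filter_upwards [hT.eventually (hV.2 ε hε), hpos] with s h1 h2
    rw [add_sub_cancel_left, inner_smul_right, norm_smul, Real.norm_eq_abs, abs_of_pos h2,
      mul_left_comm] at h1
    exact le_of_mul_le_mul_left h1 h2
  have hlim : Tendsto (fun ε : ℝ => ε * ‖R 0‖) (𝓝[>] 0) (𝓝 0) := by
    have h1 : Continuous fun ε : ℝ => ε * ‖R 0‖ := by fun_prop
    simpa using (h1.tendsto 0).mono_left nhdsWithin_le_nhds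
  have h0 : ⟪V, R 0⟫ ≤ 0 := ge_of_tendsto hlim (by
    filter_upwards [hpos] with ε hε
    exact hfin ε hε)
  rw [inner_toLp_fst_snd] at h0
  simpa [hR] using h0

/-- The limiting subgradients of a hypoconvex function are its proximal subgradients with the
uniform modulus. -/
theorem mem_subdifferential_iff_isProxSubgradient {φ : E → EReal} {ρ : ℝ} (hρ : 0 < ρ)
    {G : Set (E × ℝ)} (hG : ∀ w (a : ℝ), φ w ≤ a ↔ (w, a) ∈ G)
    (hconv : ∀ (a b : E) (α β s : ℝ), (a, α) ∈ G → (b, β) ∈ G → 0 ≤ s → s ≤ 1 →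
      (a + s • (b - a), (1 - s) * α + s * β + ρ / 2 * (s * (1 - s) * ‖b - a‖ ^ 2)) ∈ G)
    (z y : E) : y ∈ subdifferential φ z ↔ IsProxSubgradient G ρ z y := by
  constructor
  · rintro ⟨α, hα, -, Q, V, -, hQ, hV, hreg⟩
    refine ⟨α, (hG _ _).1 hα.le, ?_⟩
    rintro ⟨w, β⟩ hβ
    have hof := WithLp.prod_continuous_ofLp 2 E ℝ
    have hfst := continuous_fst.comp hof
    have hsnd := continuous_snd.comp hof
    have hQ1 : Tendsto (fun k => (Q k).fst) atTop (𝓝 z) := (hfst.tendsto _).comp hQ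
    have hQ2 : Tendsto (fun k => (Q k).snd) atTop (𝓝 α) := (hsnd.tendsto _).comp hQ
    have hV1 : Tendsto (fun k => (V k).fst) atTop (𝓝 y) := (hfst.tendsto _).comp hV
    have hV2 : Tendsto (fun k => (V k).snd) atTop (𝓝 (-1)) := (hsnd.tendsto _).comp hV
    have hd := (tendsto_const_nhds (x := w)).sub hQ1
    have h1 := (hV1.inner hd).add (hV2.mul ((hQ2.const_sub β).add
      ((hd.norm.pow 2).const_mul (ρ / 2))))
    -- The modulus `ρ` is the same at all points `Q k`, so the inequality survives the limit.
    have h2 := le_of_tendsto' h1 fun k =>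
      inner_le_of_mem_regularNormalCone_epigraph (φ := φ) (by simpa only [hG] using hconv)
        (hreg k) ((hG _ _).2 hβ)
    simp only
    linarith
  · rintro ⟨b, hb, hsub⟩
    -- The inequality tested at `z` itself shows that no height below `b` is attained.
    have hφ : φ z = b := by
      refine le_antisymm ((hG _ _).2 hb) (not_lt.1 fun hlt => ?_)
      obtain ⟨c, hc, hcb⟩ := EReal.lt_iff_exists_real_btwn.1 hlt
      have h1 := hsub _ ((hG _ _).1 hc.le)
      have h2 := EReal.coe_lt_coe_iff.1 hcb
      simp only [sub_self, inner_zero_right, norm_zero] at h1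
      linarith
    refine ⟨b, hφ, regularNormalCone_subset_normalCone _ _ ⟨hφ.le, fun ε hε => ?_⟩⟩
    set P : WithLp 2 (E × ℝ) := WithLp.toLp 2 (z, b) with hP
    have hT : Tendsto (fun q => ρ / 2 * ‖q - P‖) (𝓝[epigraph φ] P) (𝓝 0) := by
      have h1 : Continuous fun q => ρ / 2 * ‖q - P‖ := by fun_prop
      simpa using (h1.tendsto P).mono_left nhdsWithin_le_nhds
    filter_upwards [hT.eventually (gt_mem_nhds hε), self_mem_nhdsWithin] with q h1 h2
    have h3 := hsub (q.fst, q.snd) ((hG _ _).1 h2)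
    have h4 : ‖q.fst - z‖ ^ 2 ≤ ‖q - P‖ ^ 2 := by
      rw [WithLp.prod_norm_sq_eq_of_L2]
      have := sq_nonneg ‖(q - P).snd‖
      simpa [hP] using this
    have h5 := mul_le_mul_of_nonneg_right h1.le (norm_nonneg (q - P))
    have h6 := mul_le_mul_of_nonneg_left h4 (half_pos hρ).le
    rw [inner_toLp_fst_snd]
    change ⟪y, q.fst - z⟫ + (-1) * (q.snd - b) ≤ _
    simp only at h3
    linarith

end

end VarAnalysis

/-! ### Proof of the theorem -/

open VarAnalysis

theorem theorem3p7 (n : ℕ) (Ω : Set (EuclideanSpace ℝ (Fin n)))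
    (x₀ v₀ : EuclideanSpace ℝ (Fin n))
    (hclosed : IsClosed Ω) (hx₀ : x₀ ∈ Ω) (hv₀ : v₀ ∈ VarAnalysis.normalCone Ω x₀)
    (hderiv : ∀ w ∈ VarAnalysis.criticalCone Ω x₀ v₀,
      VarAnalysis.ParabolicallyDerivable Ω x₀ w)
    (hprox : VarAnalysis.ProxRegular Ω x₀ v₀)
    (hpar : VarAnalysis.ParabolicallyRegular Ω x₀ v₀) :
    -- (i) twice epi-differentiability of the indicator function
    VarAnalysis.TwiceEpiDifferentiable (VarAnalysis.indicatorFn Ω) x₀ v₀ ∧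
    -- (ii) proto-differentiability of the normal cone mapping and its graphical derivative
    (VarAnalysis.ProtoDifferentiable (VarAnalysis.normalCone Ω) x₀ v₀ ∧
      ∀ w, VarAnalysis.graphicalDeriv (VarAnalysis.normalCone Ω) x₀ v₀ w =
        VarAnalysis.subdifferential
          (fun z => ((1 / 2 : ℝ) : EReal) *
            VarAnalysis.secondSubderiv (VarAnalysis.indicatorFn Ω) x₀ v₀ z) w) ∧
    -- (iii) for all small `r > 0`, the projection is single-valued around `x₀ + r v₀`, with value
    -- `x₀` there, is semidifferentiable at this point, and `DP = (I + r DN)⁻¹`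
    (∃ r₀ > (0 : ℝ), ∀ r : ℝ, 0 < r → r < r₀ →
      ∃ p D : EuclideanSpace ℝ (Fin n) → EuclideanSpace ℝ (Fin n),
        (∀ᶠ u in 𝓝 (x₀ + r • v₀), VarAnalysis.projection Ω u = {p u}) ∧
        p (x₀ + r • v₀) = x₀ ∧
        VarAnalysis.HasSemiderivAt p D (x₀ + r • v₀) ∧
        ∀ w,
          VarAnalysis.graphicalDeriv (VarAnalysis.projection Ω) (x₀ + r • v₀) x₀ w = {D w} ∧
          VarAnalysis.graphicalDeriv (VarAnalysis.projection Ω) (x₀ + r • v₀) x₀ w =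
            VarAnalysis.inverse
              (VarAnalysis.idAddSMul r
                (VarAnalysis.graphicalDeriv (VarAnalysis.normalCone Ω) x₀ v₀)) w) := by
  obtain ⟨-, ε, hε, ρ, hρ, hineq⟩ := hprox
  have H : ProxRegularWith Ω x₀ v₀ ε ρ := ⟨hε, hρ, hv₀, hineq⟩
  have hrec := exists_recovery hx₀ H hderiv hpar
  -- The first bound yields `r * ρ < 1`, the second `4 * (r * ‖v₀‖) ≤ ε`; the `+ 1` covers `v₀ = 0`.
  set r₀ := min (1 / ρ) (ε / (4 * (‖v₀‖ + 1))) with hr₀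
  have hv1 : 0 < 4 * (‖v₀‖ + 1) := by positivity
  have hr₀pos : 0 < r₀ := lt_min (by positivity) (by positivity)
  have hadm : ∀ r, 0 < r → r < r₀ → r * ρ < 1 ∧ 4 * (r * ‖v₀‖) ≤ ε := fun r hr hrr => by
    refine ⟨(lt_div_iff₀ hρ).1 (hrr.trans_le (min_le_left _ _)), ?_⟩
    have h1 := (lt_div_iff₀ hv1).1 (hrr.trans_le (min_le_right _ _))
    linarith
  have hres : ∀ r, 0 < r → r < r₀ → ∃ p D : EuclideanSpace ℝ (Fin n) → EuclideanSpace ℝ (Fin n),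
      (∀ᶠ u in 𝓝 (x₀ + r • v₀), projection Ω u = {p u}) ∧ p (x₀ + r • v₀) = x₀ ∧
      HasSemiderivAt p D (x₀ + r • v₀) ∧
      ∀ w, IsProxSubgradient (limEpi Ω x₀ v₀) ρ (D w) (r⁻¹ • (w - D w)) := fun r hr hrr => by
    obtain ⟨h1, h2⟩ := hadm r hr hrr
    obtain ⟨p, hp, hp₀⟩ := H.exists_projection_map hclosed hx₀ hr h1 h2
    obtain ⟨D, hD, hsub⟩ := H.exists_hasSemiderivAt hx₀ hr h1 h2 hrec hp hp₀
    exact ⟨p, D, hp, hp₀, hD, hsub⟩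
  refine ⟨twiceEpiDifferentiable_indicatorFn hx₀ hrec, ?_, r₀, hr₀pos, fun r hr hrr => ?_⟩
  -- One admissible `r` suffices to describe the graphical derivative; hypoconvexity needs all of
  -- them.
  · obtain ⟨h1, h2⟩ := hadm (r₀ / 2) (half_pos hr₀pos) (half_lt_self hr₀pos)
    obtain ⟨p, D, hp, hp₀, hD, hsub⟩ := hres (r₀ / 2) (half_pos hr₀pos) (half_lt_self hr₀pos)
    set r := r₀ / 2 with hr'
    have hr : 0 < r := half_pos hr₀pos
    refine ⟨H.protoDifferentiable hclosed hx₀ hr h1 h2 hp hp₀ hD, fun z => ?_⟩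
    ext y
    rw [mem_subdifferential_iff_isProxSubgradient hρ (G := limEpi Ω x₀ v₀)
      (fun w a => half_secondSubderiv_le_iff hx₀)
      (fun a b α β s ha hb hs0 hs1 => hypoconvex_of_resolvents hρ hr₀pos (isClosed_outerLimit _)
        (fun w a a' => limEpi_upward) (fun w a h => (mem_limEpi_bounds hε H.inner_le h).2)
        (fun r hr hrr w => by
          obtain ⟨-, D, -, -, -, h⟩ := hres r hr hrr
          exact ⟨D w, h w⟩) ha hb hs0 hs1)]
    have hy : r⁻¹ • (z + r • y - z) = y := by
      rw [add_sub_cancel_left, smul_smul, inv_mul_cancel₀ hr.ne', one_smul]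
    have hiff := H.graphicalDeriv_projection_iff hclosed hx₀ hr h1 h2 (z + r • y) z
    have hsing := graphicalDeriv_eq_singleton_of_hasSemiderivAt hp hD (z + r • y)
    rw [hp₀] at hsing
    rw [hy, hsing, Set.mem_singleton_iff] at hiff
    rw [← hiff]
    constructor
    · intro h
      have := hsub (z + r • y)
      rwa [← h, hy] at this
    · intro h
      refine IsProxSubgradient.resolvent_unique hr h1 (w := z + r • y) ?_ (hsub _)
      rwa [hy]
  · obtain ⟨h1, h2⟩ := hadm r hr hrr
    obtain ⟨p, D, hp, hp₀, hD, -⟩ := hres r hr hrr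
    refine ⟨p, D, hp, hp₀, hD, fun w => ⟨?_, ?_⟩⟩
    · have := graphicalDeriv_eq_singleton_of_hasSemiderivAt hp hD w
      rwa [hp₀] at this
    · ext z
      rw [H.graphicalDeriv_projection_iff hclosed hx₀ hr h1 h2]
      constructor
      · intro h
        refine ⟨_, h, ?_⟩
        rw [smul_smul, mul_inv_cancel₀ hr.ne', one_smul, add_sub_cancel]
      · rintro ⟨y, hy, rfl⟩
        rwa [add_sub_cancel_left, smul_smul, inv_mul_cancel₀ hr.ne', one_smul]
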